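/- Let $A$ be a finite alphabet and let $\mathcal{C}$ be a quotient-closed Boolean algebra of group languages over $A$, that is, a nonempty set of languages $L \subseteq A^*$, each recognized by a monoid morphism from $A^*$ to a finite group, which is closed under union, intersection and complement and under the quotients $w^{-1}L = \{u \in A^* \mid wu \in L\}$ and $Lw^{-1} = \{u \in A^* \mid uw \in L\}$ for every $w \in A^*$. Let $SF(\mathcal{C})$ be the star-free closure of $\mathcal{C}$: the least class of languages over $A$ that contains $\mathcal{C}$ and the singletons $\{a\}$ for all $a \in A$, and is closed under union, intersection, complement and concatenation. For a class $\mathcal{D}$ of languages over $A$, consider the following problems, in which regular languages are given by finite automata. - $\mathcal{D}$-membership: given a regular language $L$, is $L \in \mathcal{D}$? - $\mathcal{D}$-separation: given two regular languages $L_1, L_2$, is there $K \in \mathcal{D}$ such that $L_1 \subseteq K$ and $L_2 \cap K = \emptyset$? - $\mathcal{D}$-covering: given a regular language $L_1$ and a finite set $\mathbf{L}_2$ of regular languages, is there a finite set $\mathbf{K} \subseteq \mathcal{D}$ such that $L_1 \subseteq \bigcup_{K \in \mathbf{K}} K$ and for every $K \in \mathbf{K}$ there is $L \in \mathbf{L}_2$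 with $K \cap L = \emptyset$? If $\mathcal{C}$-separation is decidable, then $SF(\mathcal{C})$-membership, $SF(\mathcal{C})$-separation and $SF(\mathcal{C})$-covering are all decidable. -/

import Mathlib

namespace StarFree

/-! ### Classes of languages -/

/-- `C` is a quotient-closed Boolean algebra of languages over `A`: a nonempty set of languages
closed under union, intersection, complement (in `A*`), left quotients
`w⁻¹L = {u | wu ∈ L}` and right quotients `Lw⁻¹ = {u | uw ∈ L}`. -/
structure IsQuotientClosedBooleanAlgebra {A : Type*} (C : Set (Language A)) : Prop where
  nonempty : C.Nonempty
  union_mem : ∀ K ∈ C, ∀ L ∈ C, K ⊔ L ∈ C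
  inter_mem : ∀ K ∈ C, ∀ L ∈ C, K ⊓ L ∈ C
  compl_mem : ∀ L ∈ C, Lᶜ ∈ C
  leftQuotient_mem : ∀ L ∈ C, ∀ w : List A, ({u | w ++ u ∈ L} : Language A) ∈ C
  rightQuotient_mem : ∀ L ∈ C, ∀ w : List A, ({u | u ++ w ∈ L} : Language A) ∈ C

/-- `L` is a group language: it is recognized by a monoid morphism from `A*` to a finite group. -/
def IsGroupLanguage {A : Type*} (L : Language A) : Prop :=
  ∃ (G : Type) (_ : Group G) (_ : Finite G) (α : FreeMonoid A →* G) (F : Set G),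
    ∀ w : List A, w ∈ L ↔ α (FreeMonoid.ofList w) ∈ F

/-- Membership in the least class of languages that contains `C` and the singletons
`{a}` for all letters `a`, and is closed under union, intersection, complement and
concatenation. -/
inductive InStarFreeClosure {A : Type*} (C : Set (Language A)) : Language A → Prop
  | base (L : Language A) (hL : L ∈ C) : InStarFreeClosure C L
  | letter (a : A) : InStarFreeClosure C {[a]}
  | union (K L : Language A) (hK : InStarFreeClosure C K) (hL : InStarFreeClosure C L) :
      InStarFreeClosure C (K ⊔ L)
  | inter (K L : Language A) (hK : InStarFreeClosure C K) (hL : InStarFreeClosure C L) :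
      InStarFreeClosure C (K ⊓ L)
  | compl (L : Language A) (hL : InStarFreeClosure C L) : InStarFreeClosure C Lᶜ
  | concat (K L : Language A) (hK : InStarFreeClosure C K) (hL : InStarFreeClosure C L) :
      InStarFreeClosure C (K * L)

/-- The star-free closure of the class `C`. -/
def StarFreeClosure {A : Type*} (C : Set (Language A)) : Set (Language A) :=
  {L | InStarFreeClosure C L}

/-! ### Separation and covering -/

/-- `L₁` is `C`-separable from `L₂`. -/
def Separable {A : Type*} (C : Set (Language A)) (L₁ L₂ : Language A) : Prop :=
  ∃ K ∈ C, L₁ ≤ K ∧ L₂ ⊓ K = ⊥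

/-- `K` is a `C`-cover of `L`: a finite set of languages of `C` whose union contains `L`. -/
def IsCover {A : Type*} (C : Set (Language A)) (K : Set (Language A)) (L : Language A) : Prop :=
  K.Finite ∧ K ⊆ C ∧ ∀ w ∈ L, ∃ H ∈ K, w ∈ H

/-- The pair `(L₁, L₂)`, where `L₁` is a language and `L₂` a set of languages, is
`C`-coverable. -/
def Coverable {A : Type*} (C : Set (Language A)) (L₁ : Language A) (L₂ : Set (Language A)) :
    Prop :=
  ∃ K : Set (Language A), IsCover C K L₁ ∧ ∀ H ∈ K, ∃ L ∈ L₂, H ⊓ L = ⊥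

/-! ### Finite automata as inputs of algorithms -/

/-- A finite automaton over `A` as a finite object: the list of its initial states, the list of its
transitions `(p, a, q)` and the list of its final states, the states being named by natural
numbers. -/
abbrev Automaton (A : Type*) : Type _ :=
  List ℕ × List (ℕ × A × ℕ) × List ℕ

/-- The nondeterministic automaton described by `M`. -/
def Automaton.toNFA {A : Type*} (M : Automaton A) : NFA A ℕ where
  step p a := {q | (p, a, q) ∈ M.2.1}
  start := {p | p ∈ M.1}
  accept := {p | p ∈ M.2.2}

/-- The regular language accepted by `M`. -/
def Automaton.language {A : Type*} (M : Automaton A) : Language A :=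
  (Automaton.toNFA M).accepts

/-- Every finite automaton in the above sense accepts a regular language, and over a finite
alphabet each regular language is accepted by such an automaton. -/
theorem isRegular_iff_exists_automaton {A : Type*} [Finite A] (L : Language A) :
    L.IsRegular ↔ ∃ M : Automaton A, Automaton.language M = L := by
  constructor
  · rintro ⟨σ, _, D, rfl⟩
    have := Fintype.ofFinite A
    let e : σ → ℕ := fun s => (Fintype.equivFin σ s : ℕ)
    have he : Function.Injective e :=
      fun s t h => (Fintype.equivFin σ).injective (Fin.ext h)
    let M : Automaton A :=
      ([e D.start],
        (Finset.univ : Finset (σ × A)).toList.map (fun x => (e x.1, x.2, e (D.step x.1 x.2))),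
        (D.accept.toFinite.toFinset).toList.map e)
    have hstep : ∀ s a, (Automaton.toNFA M).stepSet {e s} a = {e (D.step s a)} := by
      intro s a
      ext q
      simp only [NFA.stepSet_singleton, Automaton.toNFA, M, Set.mem_ofPred_eq, List.mem_map,
        Finset.mem_toList, Finset.mem_univ, true_and, Set.mem_singleton_iff, Prod.mk.injEq]
      constructor
      · rintro ⟨⟨s', a'⟩, h1, rfl, rfl⟩
        rw [he h1]
      · rintro rfl
        exact ⟨(s, a), rfl, rfl, rfl⟩
    have heval : ∀ (w : List A) s,
        (Automaton.toNFA M).evalFrom {e s} w = {e (D.evalFrom s w)} := by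
      intro w
      induction w with
      | nil => intro s; rfl
      | cons a w ih =>
        intro s
        have h : (Automaton.toNFA M).evalFrom {e s} (a :: w) =
            (Automaton.toNFA M).evalFrom ((Automaton.toNFA M).stepSet {e s} a) w := rfl
        rw [h, hstep, ih]
        rfl
    have hstart : (Automaton.toNFA M).start = {e D.start} := by
      ext q
      simp [Automaton.toNFA, M]
    refine ⟨M, ?_⟩
    ext w
    change (∃ S ∈ (Automaton.toNFA M).accept,
      S ∈ (Automaton.toNFA M).evalFrom (Automaton.toNFA M).start w) ↔ D.eval w ∈ D.accept
    rw [hstart, heval]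
    simp only [Set.mem_singleton_iff, exists_eq_right]
    simp only [Automaton.toNFA, M, Set.mem_ofPred_eq, List.mem_map, Finset.mem_toList,
      Set.Finite.mem_toFinset]
    constructor
    · rintro ⟨s, hs, h⟩
      rw [he h] at hs
      exact hs
    · intro h
      exact ⟨_, h, rfl⟩
  · rintro ⟨M, rfl⟩
    let N := Automaton.toNFA M
    let Q : Set ℕ := {p | p ∈ M.1 ++ M.2.1.map (fun x => x.2.2)}
    have hQ : Q.Finite := List.finite_toSet _
    have hsub : ∀ w, N.evalFrom N.start w ⊆ Q := by
      intro w
      induction w using List.reverseRecOn with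
      | nil =>
        intro p hp
        exact List.mem_append_left _ hp
      | append_singleton w a _ =>
        intro p hp
        rw [NFA.evalFrom_append, NFA.evalFrom_singleton, NFA.mem_stepSet] at hp
        obtain ⟨t, _, ht⟩ := hp
        exact List.mem_append_right _ (List.mem_map.2 ⟨(t, a, p), ht, rfl⟩)
    apply Language.IsRegular.of_finite_range_leftQuotient
    refine (hQ.finite_subsets.image (fun S => N.acceptsFrom S)).subset ?_
    rintro _ ⟨w, rfl⟩
    refine ⟨N.evalFrom N.start w, hsub w, ?_⟩
    ext u
    change u ∈ N.acceptsFrom (N.evalFrom N.start w) ↔ w ++ u ∈ N.acceptsFrom N.start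
    simp [NFA.mem_acceptsFrom, NFA.evalFrom_append]

/-! ### Decision problems -/

/-- `C`-membership is decidable: there is an algorithm that decides, given a regular language `L`,
whether `L ∈ C`. -/
def DecidableMembership {A : Type*} [Primcodable A] (C : Set (Language A)) : Prop :=
  ComputablePred fun M : Automaton A => Automaton.language M ∈ C

/-- `C`-separation is decidable: there is an algorithm that decides, given two regular languages,
whether the first one is `C`-separable from the second one. -/
def DecidableSeparation {A : Type*} [Primcodable A] (C : Set (Language A)) : Prop :=
  ComputablePred fun M : Automaton A × Automaton A =>
    Separable C (Automaton.language M.1) (Automaton.language M.2)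

/-- `C`-covering is decidable: there is an algorithm that decides, given a regular language and a
finite list of regular languages, whether this pair is `C`-coverable. -/
def DecidableCovering {A : Type*} [Primcodable A] (C : Set (Language A)) : Prop :=
  ComputablePred fun M : Automaton A × List (Automaton A) =>
    Coverable C (Automaton.language M.1) {L | ∃ N ∈ M.2, Automaton.language N = L}

end StarFree

/-! Separation from `L₂` is covering against the single language `L₂`, since star-free closures are
closed under finite unions, and a language is star-free over `C` exactly when it is separable from
its complement. So one problem has to be decided: covering, with target languages given by an
automaton and a sign (`signedLanguage`), so that no automaton is ever complemented.

All input languages are recognized by one morphism `φ` from the words to the finite monoid `M` of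
relations on the states of the disjoint union of the automata. The heart of the proof is that
coverability is equivalent to the existence of a saturated family `F` of subsets of `M`
(`IsSaturatedFamily`) such that no set in `reach F φ w`, for any word `w`, meets the accepting sets
of all the languages. A member of `F` stands for values in `M` of words that a finite set of
star-free languages cannot tell apart and whose value in a group is `1`. Saturation demands the
unit, products, and an aperiodicity condition: if `C` does not separate the empty word from the
words along which `T` is reached, then one member contains both `T ^ N` and `T ^ (N + 1)`.

A cover yields such a family (`exists_isSaturatedFamily`): star-free languages satisfy a pumping
property for words that are trivial in a suitable group (`exists_pumpedBy`), and the sets of values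
of indistinguishable words form `F`. Conversely (`coverable_of_isSaturatedFamily`), the pairs (group
value, reachable set) form a finite monoid ordered by inclusion. In it, two consecutive powers of
any element over `1` have a common upper bound. A version of Schützenberger's theorem for such
orders (`IsSaturatedOrder.hasBoundedPartition`), proved by induction through local divisors,
partitions all words into star-free languages, each with an upper bound for its values. These
languages form the cover.

Finally there are only finitely many candidates for `F`. The aperiodicity condition is checked by
the algorithm for `C`-separation, because the words that reach `T` form a regular language; all
other conditions are primitive recursive or emptiness tests, which are again instances of
separation. -/

open scoped Pointwise

namespace StarFree

/-! ### Star-free closures -/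

namespace InStarFreeClosure

variable {B : Type*} {C : Set (Language B)}

theorem of_eq {K L : Language B} (hK : InStarFreeClosure C K) (h : ∀ w, w ∈ K ↔ w ∈ L) :
    InStarFreeClosure C L := by
  have : K = L := Set.ext h
  exact this ▸ hK

theorem top (hC : C.Nonempty) : InStarFreeClosure C ⊤ := by
  obtain ⟨L, hL⟩ := hC
  refine (union _ _ (base L hL) (compl _ (base L hL))).of_eq fun w => ?_
  exact ⟨fun _ => trivial, fun _ => em _⟩

theorem bot (hC : C.Nonempty) : InStarFreeClosure C ⊥ :=
  (compl _ (top hC)).of_eq fun _ => ⟨fun h => h trivial, fun h => h.elim⟩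

theorem biUnion (hC : C.Nonempty) {ι : Type*} (s : Finset ι) (K : ι → Language B)
    (hK : ∀ i ∈ s, InStarFreeClosure C (K i)) :
    InStarFreeClosure C ({w | ∃ i ∈ s, w ∈ K i} : Language B) := by
  classical
  induction s using Finset.induction_on with
  | empty => exact (bot hC).of_eq fun w => ⟨fun h => h.elim, fun ⟨i, hi, _⟩ => by simp at hi⟩
  | insert i s _ ih =>
    refine (union _ _ (hK i (by simp)) (ih fun j hj => hK j (by simp [hj]))).of_eq fun w => ?_
    change (w ∈ K i ∨ ∃ j ∈ s, w ∈ K j) ↔ ∃ j ∈ insert i s, w ∈ K j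
    simp

theorem iUnion (hC : C.Nonempty) {ι : Type*} [Finite ι] (K : ι → Language B)
    (hK : ∀ i, InStarFreeClosure C (K i)) :
    InStarFreeClosure C ({w | ∃ i, w ∈ K i} : Language B) := by
  have := Fintype.ofFinite ι
  exact (biUnion hC Finset.univ K fun i _ => hK i).of_eq fun w => by
    change (∃ i ∈ Finset.univ, w ∈ K i) ↔ ∃ i, w ∈ K i
    simp

theorem diff {K L : Language B} (hK : InStarFreeClosure C K) (hL : InStarFreeClosure C L) :
    InStarFreeClosure C ({w | w ∈ K ∧ w ∉ L} : Language B) :=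
  (inter _ _ hK (compl _ hL)).of_eq fun _ => Iff.rfl

theorem and_const (hC : C.Nonempty) {K : Language B} (hK : InStarFreeClosure C K) (p : Prop) :
    InStarFreeClosure C ({w | w ∈ K ∧ p} : Language B) := by
  by_cases hp : p
  · exact hK.of_eq fun w => ⟨fun h => ⟨h, hp⟩, fun h => h.1⟩
  · exact (bot hC).of_eq fun w => ⟨fun h => h.elim, fun h => hp h.2⟩

/-- The words all of whose letters belong to `s`. -/
theorem words [Finite B] (hC : C.Nonempty) (s : Set B) :
    InStarFreeClosure C ({w | ∀ b ∈ w, b ∈ s} : Language B) := by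
  refine (compl _ (iUnion hC (fun b : {b : B // b ∉ s} => ⊤ * {[b.1]} * ⊤) fun b =>
    concat _ _ (concat _ _ (top hC) (letter b.1)) (top hC))).of_eq fun w => ?_
  change (¬ ∃ b : {b : B // b ∉ s}, w ∈ (⊤ * {[b.1]} * ⊤ : Language B)) ↔ ∀ b ∈ w, b ∈ s
  constructor
  · intro h b hb
    by_contra hbs
    obtain ⟨u, v, rfl⟩ := List.append_of_mem hb
    exact h ⟨⟨b, hbs⟩, Language.mem_mul.2 ⟨u ++ [b],
      Language.mem_mul.2 ⟨u, trivial, [b], rfl, rfl⟩, v, trivial, by simp⟩⟩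
  · rintro h ⟨⟨b, hb⟩, hw⟩
    obtain ⟨_, h1, v, -, rfl⟩ := Language.mem_mul.1 hw
    obtain ⟨u, -, _, rfl, rfl⟩ := Language.mem_mul.1 h1
    exact hb (h b (by simp))

theorem mono {D : Set (Language B)} (h : ∀ L ∈ C, InStarFreeClosure D L) {L : Language B}
    (hL : InStarFreeClosure C L) : InStarFreeClosure D L := by
  induction hL with
  | base L hL => exact h L hL
  | letter a => exact letter a
  | union K L _ _ hK hL => exact union _ _ hK hL
  | inter K L _ _ hK hL => exact inter _ _ hK hL
  | compl L _ hL => exact compl _ hL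
  | concat K L _ _ hK hL => exact concat _ _ hK hL

end InStarFreeClosure

/-- A finite star-free cover whose members `K i` are bounded by `b i` can be turned into a
star-free partition, presented as the fibres of a map to the bounds. -/
theorem exists_partition_of_cover {B S ι : Type*} {C : Set (Language B)} (hC : C.Nonempty)
    (P : List B → S → Prop) (K : ι → Language B) (hK : ∀ i, InStarFreeClosure C (K i))
    (b : ι → S) (hb : ∀ i, ∀ w ∈ K i, P w (b i)) (s₀ : S) (s : Finset ι) :
    ∃ κ : List B → S,
      (∀ t, InStarFreeClosure C ({w | (∃ i ∈ s, w ∈ K i) ∧ κ w = t} : Language B)) ∧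
        ∀ w, (∃ i ∈ s, w ∈ K i) → P w (κ w) := by
  classical
  induction s using Finset.induction_on with
  | empty =>
    refine ⟨fun _ => s₀, fun t => (InStarFreeClosure.bot hC).of_eq fun w => ?_, ?_⟩
    · exact ⟨fun h => h.elim, fun ⟨⟨i, hi, _⟩, _⟩ => by simp at hi⟩
    · rintro w ⟨i, hi, _⟩
      simp at hi
  | insert i s _ ih =>
    obtain ⟨κ, h1, h2⟩ := ih
    -- The newest member of the cover takes precedence, which makes the pieces disjoint.
    refine ⟨fun w => if w ∈ K i then b i else κ w, fun t => ?_, ?_⟩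
    · refine (InStarFreeClosure.union _ _ ((hK i).and_const hC (b i = t))
        ((h1 t).diff (hK i))).of_eq fun w => ?_
      change ((w ∈ K i ∧ b i = t) ∨ (((∃ j ∈ s, w ∈ K j) ∧ κ w = t) ∧ w ∉ K i)) ↔
        (∃ j ∈ insert i s, w ∈ K j) ∧ (if w ∈ K i then b i else κ w) = t
      by_cases hw : w ∈ K i <;> simp [hw]
    · rintro w ⟨j, hj, hw⟩
      by_cases hwi : w ∈ K i
      · simpa [hwi] using hb i w hwi
      · simp only [hwi, if_false]
        rcases Finset.mem_insert.1 hj with rfl | hj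
        · exact absurd hw hwi
        · exact h2 w ⟨j, hj, hw⟩

/-! ### Saturated orders and local monoids -/

/-- A monotone preorder on a monoid over a group, in which every element `s` over `1` has two
consecutive powers with a common upper bound. -/
structure IsSaturatedOrder {S G : Type*} [Monoid S] [Group G] (π : S →* G) (le : S → S → Prop) :
    Prop where
  refl : ∀ s, le s s
  trans : ∀ s t u, le s t → le t u → le s u
  mul : ∀ s s' t t', le s s' → le t t' → le (s * t) (s' * t')
  map_eq : ∀ s t, le s t → π s = π t
  pow : ∀ s, π s = 1 → ∃ n t, le (s ^ n) t ∧ le (s ^ (n + 1)) t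

/-- The submonoid `{x} ∪ xSx` of the local divisor of `S` at `x`. -/
def LocalMonoid {S : Type*} [Monoid S] (x : S) : Type _ :=
  {z : S // ∃ y, z = y * x ∧ (y = 1 ∨ ∃ g, y = x * g)}

namespace LocalMonoid

variable {S : Type*} [Monoid S] {x : S}

/-- The underlying element of `S`. -/
def val (z : LocalMonoid x) : S := Subtype.val z

theorem val_injective : Function.Injective (val : LocalMonoid x → S) :=
  Subtype.val_injective

instance [Finite S] : Finite (LocalMonoid x) :=
  Finite.of_injective _ val_injective

/-- A left factor of `z` with respect to `x`. -/
noncomputable def left (z : LocalMonoid x) : S := z.2.choose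

theorem val_eq (z : LocalMonoid x) : z.val = z.left * x := z.2.choose_spec.1

theorem left_cases (z : LocalMonoid x) : z.left = 1 ∨ ∃ g, z.left = x * g := z.2.choose_spec.2

theorem exists_right (z : LocalMonoid x) : ∃ v, z.val = x * v := by
  rw [val_eq]
  rcases z.left_cases with h | ⟨g, h⟩
  · exact ⟨1, by simp [h]⟩
  · exact ⟨g * x, by rw [h, mul_assoc]⟩

/-- Every element of the local monoid also has the form `x * v`, so `y * w.val = (y * x) * v`
depends only on `y * x`. Hence the product does not depend on the left factor chosen by `left`. -/
theorem mul_val_congr {y y' : S} (h : y * x = y' * x) (w : LocalMonoid x) :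
    y * w.val = y' * w.val := by
  obtain ⟨v, hv⟩ := w.exists_right
  rw [hv, ← mul_assoc, h, mul_assoc]

noncomputable instance : Mul (LocalMonoid x) where
  mul z w := ⟨z.left * w.val, by
    rcases z.left_cases with h | ⟨g, h⟩
    · exact ⟨w.left, by rw [h, one_mul, val_eq], w.left_cases⟩
    · exact ⟨z.left * w.left, by rw [val_eq, mul_assoc], Or.inr ⟨g * w.left, by rw [h, mul_assoc]⟩⟩⟩

instance : One (LocalMonoid x) where
  one := ⟨x, 1, by simp⟩

theorem val_mul (z w : LocalMonoid x) : (z * w).val = z.left * w.val := rfl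

theorem val_one : (1 : LocalMonoid x).val = x := rfl

theorem val_mul_of_eq {z : LocalMonoid x} {y : S} (h : z.val = y * x) (w : LocalMonoid x) :
    (z * w).val = y * w.val := by
  rw [val_mul]
  exact mul_val_congr (by rw [← val_eq, h]) w

noncomputable instance : Monoid (LocalMonoid x) where
  mul_assoc u v w := val_injective <| by
    rw [val_mul_of_eq (y := u.left * v.left) (by rw [val_mul, val_eq v, mul_assoc]), val_mul,
      val_mul, mul_assoc]
  one_mul w := val_injective <| by rw [val_mul_of_eq (y := 1) (by rw [val_one, one_mul]), one_mul]
  mul_one w := val_injective <| by rw [val_mul, val_one, ← val_eq]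

/-- The element `x t x`. -/
def conj (x t : S) : LocalMonoid x := ⟨x * t * x, x * t, rfl, Or.inr ⟨t, rfl⟩⟩

theorem val_conj (t : S) : (conj x t).val = x * t * x := rfl

theorem val_conj_mul (t : S) (w : LocalMonoid x) : (conj x t * w).val = x * t * w.val :=
  val_mul_of_eq (val_conj t) w

theorem val_conj_pow (t : S) (n : ℕ) : (conj x t ^ n).val = (x * t) ^ n * x := by
  induction n with
  | zero => simp [val_one]
  | succ n ih => rw [pow_succ', val_conj_mul, ih, pow_succ', ← mul_assoc]

theorem eq_one_or_conj (z : LocalMonoid x) : z = 1 ∨ ∃ t, z = conj x t := by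
  rcases z.left_cases with h | ⟨g, h⟩
  · exact Or.inl (val_injective (by rw [val_eq, h, one_mul, val_one]))
  · exact Or.inr ⟨g, val_injective (by rw [val_eq, h, val_conj])⟩

/-- The element `1` of `S` is missed: `x * t * x = 1` would give `x` a right inverse and a left
inverse. This drives the induction on the size of the monoid. -/
theorem card_lt [Finite S] (hx : ¬ IsUnit x) : Nat.card (LocalMonoid x) < Nat.card S := by
  have h1 : ∀ z : LocalMonoid x, z.val ≠ 1 := by
    intro z hz
    rcases z.eq_one_or_conj with rfl | ⟨t, rfl⟩
    · exact hx (by rw [← val_one (x := x), hz]; exact isUnit_one)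
    · rw [val_conj] at hz
      have : x * (t * x) = 1 := by rw [← mul_assoc, hz]
      exact hx (isUnit_iff_exists.2 ⟨t * x, this, by
        have h2 : (x * t) * x = 1 := hz
        have h3 : x * t = t * x := left_inv_eq_right_inv h2 this
        rw [← h3, h2]⟩)
  have : Fintype S := Fintype.ofFinite S
  have : Fintype (LocalMonoid x) := Fintype.ofFinite _
  rw [Nat.card_eq_fintype_card, Nat.card_eq_fintype_card]
  exact Fintype.card_lt_of_injective_of_notMem val val_injective (b := 1)
    (by rintro ⟨z, hz⟩; exact h1 z hz)

variable {G : Type*} [Group G]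

/-- The morphism to `G` which a morphism from `S` to `G` induces. -/
noncomputable def hom (π : S →* G) (x : S) : LocalMonoid x →* G where
  toFun z := π z.val * (π x)⁻¹
  map_one' := by rw [val_one, mul_inv_cancel]
  map_mul' z w := by
    rw [val_mul, val_eq z]
    simp [mul_assoc]

theorem hom_apply (π : S →* G) (z : LocalMonoid x) : hom π x z = π z.val * (π x)⁻¹ := rfl

/-- Powers of `x * t * x` in the local monoid are `(x * t) ^ n * x`, and `x * t` lies over `1` when
`x * t * x` does with respect to `hom π x`. So common bounds are inherited from `S`. -/
theorem isSaturatedOrder {π : S →* G} {le : S → S → Prop} (h : IsSaturatedOrder π le) (x : S) :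
    IsSaturatedOrder (hom π x) fun z w => le z.val w.val where
  refl z := h.refl _
  trans _ _ _ := h.trans _ _ _
  mul z z' w w' hz hw := by
    obtain ⟨v, hv⟩ := w.exists_right
    have h1 : le (z * w).val (z' * w).val := by
      rw [val_mul, val_mul, hv, ← mul_assoc, ← mul_assoc, ← val_eq, ← val_eq]
      exact h.mul _ _ _ _ hz (h.refl _)
    refine h.trans _ _ _ h1 ?_
    rw [val_mul, val_mul]
    exact h.mul _ _ _ _ (h.refl _) hw
  map_eq z w hzw := by rw [hom_apply, hom_apply, h.map_eq _ _ hzw]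
  pow z hz := by
    rcases z.eq_one_or_conj with rfl | ⟨g, rfl⟩
    · exact ⟨0, 1, by simpa using h.refl _, by simpa using h.refl _⟩
    · obtain ⟨n, t, h1, h2⟩ := h.pow (x * g) (by
        rw [hom_apply, val_conj, map_mul _ (x * g)] at hz
        simpa using hz)
      -- The bound `t` need not lie in the local monoid; one more factor `x * g` on its left turns
      -- it into `x * (g * t) * x`, at the price of raising the exponent by one.
      refine ⟨n + 1, conj x (g * t), ?_, ?_⟩
      · rw [val_conj_pow, val_conj, pow_succ', ← mul_assoc x g t]
        exact h.mul _ _ _ _ (h.mul _ _ _ _ (h.refl _) h1) (h.refl _)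
      · rw [val_conj_pow, val_conj, pow_succ', ← mul_assoc x g t]
        exact h.mul _ _ _ _ (h.mul _ _ _ _ (h.refl _) h2) (h.refl _)

end LocalMonoid

/-- If `u ^ n` and `u ^ (n + 1)` lie below `t`, then `1` and `u` lie below `t * u⁻¹ ^ n`.
Multiplying such bounds over the finitely many units over `1` bounds all of them at once, because
each factor is also above `1`. -/
theorem IsSaturatedOrder.exists_bound_units {S G : Type*} [Monoid S] [Finite S] [Group G]
    {π : S →* G} {le : S → S → Prop} (h : IsSaturatedOrder π le) :
    ∃ p, ∀ u : Sˣ, π u = 1 → le u p := by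
  classical
  have := Fintype.ofFinite S
  have key : ∀ s : Finset Sˣ, ∃ p, le 1 p ∧ ∀ u ∈ s, π u = 1 → le u p := by
    intro s
    induction s using Finset.induction_on with
    | empty => exact ⟨1, h.refl _, by simp⟩
    | insert u s _ ih =>
      obtain ⟨p, h1, h2⟩ := ih
      by_cases hu : π u = 1
      · obtain ⟨n, t, h3, h4⟩ := h.pow u hu
        have h5 : le 1 (t * ((u⁻¹ ^ n : Sˣ) : S)) := by
          have := h.mul _ _ _ _ h3 (h.refl ((u⁻¹ ^ n : Sˣ) : S))
          rwa [← Units.val_pow_eq_pow_val, ← Units.val_mul, inv_pow, mul_inv_cancel,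
            Units.val_one, ← inv_pow] at this
        have h6 : le u (t * ((u⁻¹ ^ n : Sˣ) : S)) := by
          have := h.mul _ _ _ _ h4 (h.refl ((u⁻¹ ^ n : Sˣ) : S))
          rwa [← Units.val_pow_eq_pow_val, ← Units.val_mul, inv_pow, pow_succ',
            mul_inv_cancel_right, ← inv_pow] at this
        refine ⟨t * ((u⁻¹ ^ n : Sˣ) : S) * p, by simpa using h.mul _ _ _ _ h5 h1, ?_⟩
        intro v hv hv1
        rcases Finset.mem_insert.1 hv with rfl | hv
        · simpa using h.mul _ _ _ _ h6 h1
        · simpa using h.mul _ _ _ _ h5 (h2 v hv hv1)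
      · refine ⟨p, h1, fun v hv hv1 => ?_⟩
        rcases Finset.mem_insert.1 hv with rfl | hv
        · exact absurd hv1 hu
        · exact h2 v hv hv1
  obtain ⟨p, -, hp⟩ := key Finset.univ
  exact ⟨p, fun u hu => hp u (Finset.mem_univ _) hu⟩

/-! ### Star-free partitions bounded in a saturated order -/

/-- The value in `S` of a word over `B` whose letters are mapped to `S` by `f`. -/
def wordValue {B S : Type*} [Monoid S] (f : B → S) (w : List B) : S := (w.map f).prod

theorem wordValue_append {B S : Type*} [Monoid S] (f : B → S) (u v : List B) :
    wordValue f (u ++ v) = wordValue f u * wordValue f v := by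
  simp [wordValue]

theorem wordValue_cons {B S : Type*} [Monoid S] (f : B → S) (b : B) (v : List B) :
    wordValue f (b :: v) = f b * wordValue f v := by
  simp [wordValue]

theorem wordValue_nil {B S : Type*} [Monoid S] (f : B → S) : wordValue f [] = 1 := rfl

/-- The languages of the words over `B` with a given value in `G`. -/
def fiberClass {B S G : Type*} [Monoid S] [Group G] (π : S →* G) (f : B → S) :
    Set (Language B) :=
  {L | ∃ g, L = ({w | π (wordValue f w) = g} : Language B)}

theorem fiberClass_nonempty {B S G : Type*} [Monoid S] [Group G] (π : S →* G) (f : B → S) :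
    (fiberClass π f).Nonempty := ⟨_, 1, rfl⟩

theorem starFree_fiber {B S G : Type*} [Monoid S] [Group G] (π : S →* G) (f : B → S) (g : G) :
    InStarFreeClosure (fiberClass π f) ({w | π (wordValue f w) = g} : Language B) :=
  .base _ ⟨g, rfl⟩

theorem starFree_of_value {B S G : Type*} [Monoid S] [Finite S] [Group G] (π : S →* G)
    (f : B → S) (p : G → Prop) :
    InStarFreeClosure (fiberClass π f) ({w | p (π (wordValue f w))} : Language B) := by
  -- `G` may be infinite, but only values in the image of the finite monoid `S` occur, so the union
  -- is indexed by `S`.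
  refine (InStarFreeClosure.iUnion (fiberClass_nonempty π f)
    (fun s : {s : S // p (π s)} => ({w | π (wordValue f w) = π s.1} : Language B))
    fun s => starFree_fiber π f _).of_eq fun w => ?_
  change (∃ s : {s : S // p (π s)}, π (wordValue f w) = π s.1) ↔ p (π (wordValue f w))
  constructor
  · rintro ⟨⟨s, hs⟩, h⟩
    rw [h]
    exact hs
  · intro h
    exact ⟨⟨_, h⟩, rfl⟩

/-- A star-free partition of the words over `s ⊆ B`, given by the fibres of a map to `S` which
bounds the values. -/
def HasBoundedPartition {B S G : Type*} [Monoid S] [Group G] (π : S →* G) (le : S → S → Prop)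
    (f : B → S) (s : Set B) : Prop :=
  ∃ κ : List B → S,
    (∀ t, InStarFreeClosure (fiberClass π f)
      ({w | (∀ b ∈ w, b ∈ s) ∧ κ w = t} : Language B)) ∧
    ∀ w : List B, (∀ b ∈ w, b ∈ s) → le (wordValue f w) (κ w)

/-- Base case: the group value alone determines the piece. If `v` and `w` have the same group value,
then `w = v * (v⁻¹ * w)` in terms of values, and `v⁻¹ * w` is a unit over `1`, so `v * p` bounds the
value of `w`. -/
theorem hasBoundedPartition_of_units {B S G : Type*} [Finite B] [Monoid S] [Finite S] [Group G]
    {π : S →* G} {le : S → S → Prop} (h : IsSaturatedOrder π le) (f : B → S) (s : Set B)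
    (hs : ∀ b ∈ s, IsUnit (f b)) : HasBoundedPartition π le f s := by
  obtain ⟨p, hp⟩ := h.exists_bound_units
  have hunit : ∀ w : List B, (∀ b ∈ w, b ∈ s) → IsUnit (wordValue f w) := by
    intro w
    induction w with
    | nil => exact fun _ => isUnit_one
    | cons b w ih =>
      intro hw
      rw [wordValue_cons]
      exact (hs b (hw b (by simp))).mul (ih fun c hc => hw c (by simp [hc]))
  have key : ∀ g : G, ∃ t, ∀ w : List B, (∀ b ∈ w, b ∈ s) → π (wordValue f w) = g →
      le (wordValue f w) t := by
    intro g
    by_cases hg : ∃ w : List B, (∀ b ∈ w, b ∈ s) ∧ π (wordValue f w) = g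
    · obtain ⟨v, hv, hvg⟩ := hg
      refine ⟨wordValue f v * p, fun w hw hwg => ?_⟩
      obtain ⟨x, hx⟩ := hunit v hv
      obtain ⟨y, hy⟩ := hunit w hw
      have h1 : π ((x⁻¹ * y : Sˣ) : S) = 1 := by
        have h2 : π ((x⁻¹ : Sˣ) : S) * π x = 1 := by rw [← map_mul, Units.inv_mul, map_one]
        rw [Units.val_mul, map_mul, hy, hwg, ← hvg, ← hx, h2]
      have h3 := h.mul _ _ _ _ (h.refl x) (hp _ h1)
      rwa [Units.val_mul, Units.mul_inv_cancel_left, hx, hy] at h3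
    · exact ⟨1, fun w hw hwg => absurd ⟨w, hw, hwg⟩ hg⟩
  choose t ht using key
  refine ⟨fun w => t (π (wordValue f w)), fun r => ?_, fun w hw => ht _ w hw rfl⟩
  exact (InStarFreeClosure.inter _ _ (InStarFreeClosure.words (fiberClass_nonempty π f) s)
    (starFree_of_value π f fun g => t g = r)).of_eq fun w => Iff.rfl

/-! ### Factorization of words along a letter, and lifting from the alphabet of blocks -/

/-- The concatenation of the words of a list, each of them followed by the letter `c`. -/
def joinWith {B : Type*} (c : B) (l : List (List B)) : List B := l.flatMap fun k => k ++ [c]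

theorem joinWith_cons {B : Type*} (c : B) (k : List B) (l : List (List B)) :
    joinWith c (k :: l) = k ++ c :: joinWith c l := by
  simp [joinWith]

theorem joinWith_append {B : Type*} (c : B) (l l' : List (List B)) :
    joinWith c (l ++ l') = joinWith c l ++ joinWith c l' := by
  simp [joinWith]

theorem append_cons_injective {B : Type*} {c : B} {k k' r r' : List B} (hk : c ∉ k)
    (hk' : c ∉ k') (h : k ++ c :: r = k' ++ c :: r') : k = k' ∧ r = r' := by
  induction k generalizing k' with
  | nil =>
    cases k' with
    | nil => simpa using h
    | cons b k' => simp at h hk'; exact absurd h.1 hk'.1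
  | cons a k ih =>
    cases k' with
    | nil => simp at h hk; exact absurd h.1.symm hk.1
    | cons b k' =>
      simp only [List.mem_cons, not_or, List.cons_append, List.cons.injEq] at h hk hk' ⊢
      have := ih hk.2 hk'.2 h.2
      exact ⟨⟨h.1, this.1⟩, this.2⟩

theorem joinWith_injective {B : Type*} (c : B) (l l' : List (List B)) (hl : ∀ k ∈ l, c ∉ k)
    (hl' : ∀ k ∈ l', c ∉ k) (h : joinWith c l = joinWith c l') : l = l' := by
  induction l generalizing l' with
  | nil =>
    cases l' with
    | nil => rfl
    | cons k l' => simp [joinWith] at h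
  | cons k l ih =>
    cases l' with
    | nil => simp [joinWith] at h
    | cons k' l' =>
      rw [joinWith_cons, joinWith_cons] at h
      obtain ⟨rfl, h'⟩ := append_cons_injective (hl k (by simp)) (hl' k' (by simp)) h
      rw [ih l' (fun k hk => hl k (by simp [hk])) (fun k hk => hl' k (by simp [hk])) h']

theorem exists_joinWith {B : Type*} (c : B) (w : List B) :
    ∃ (l : List (List B)) (k : List B), (∀ k ∈ l, c ∉ k) ∧ c ∉ k ∧ w = joinWith c l ++ k := by
  induction w with
  | nil => exact ⟨[], [], by simp, by simp, rfl⟩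
  | cons b w ih =>
    obtain ⟨l, k, h1, h2, rfl⟩ := ih
    by_cases hb : b = c
    · subst hb
      exact ⟨[] :: l, k, by simpa using h1, h2, by simp [joinWith_cons]⟩
    · cases l with
      | nil => exact ⟨[], b :: k, by simp, by simp [Ne.symm hb, h2], by simp [joinWith]⟩
      | cons k' l =>
        refine ⟨(b :: k') :: l, k, ?_, h2, by simp [joinWith_cons]⟩
        intro j hj
        rcases List.mem_cons.1 hj with rfl | hj
        · simp [Ne.symm hb, h1 k' (by simp)]
        · exact h1 j (by simp [hj])

theorem mem_joinWith {B : Type*} {c b : B} {l : List (List B)} :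
    b ∈ joinWith c l ↔ ∃ k ∈ l, b ∈ k ∨ b = c := by
  simp [joinWith]

/-- The words `k₁ c k₂ c ⋯ kₙ c` such that every `kᵢ` is a word over `s` without the letter `c`,
and the word of the images of the `kᵢ` under `κ` belongs to `U`. -/
def lift {B S : Type*} (c : B) (s : Set B) (κ : List B → S) (U : Language S) : Language B :=
  {w | ∃ l : List (List B), (∀ k ∈ l, ∀ b ∈ k, b ∈ s \ {c}) ∧ w = joinWith c l ∧ l.map κ ∈ U}

theorem map_mem_of_mem_lift {B S : Type*} {c : B} {s : Set B} {κ : List B → S} {U : Language S}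
    {l : List (List B)} (hl : ∀ k ∈ l, ∀ b ∈ k, b ∈ s \ {c})
    (h : joinWith c l ∈ lift c s κ U) : l.map κ ∈ U := by
  obtain ⟨l', hl', h1, h2⟩ := h
  rwa [joinWith_injective c l l' (fun k hk hc => (hl k hk c hc).2 rfl)
    (fun k hk hc => (hl' k hk c hc).2 rfl) h1]

/-- These are the words over `s` that are empty or end with `c`, whatever `κ` is. -/
theorem lift_top {B S G : Type*} [Finite B] [Monoid S] [Group G] (π : S →* G) (f : B → S)
    {c : B} {s : Set B} (hc : c ∈ s) (κ : List B → S) :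
    InStarFreeClosure (fiberClass π f) (lift c s κ ⊤) := by
  have hne := fiberClass_nonempty π f
  refine (InStarFreeClosure.inter _ _ (.words hne s) (.union _ _ (.words hne ∅)
    (.concat _ _ (.top hne) (.letter c)))).of_eq fun w => ?_
  change ((∀ b ∈ w, b ∈ s) ∧ ((∀ b ∈ w, b ∈ (∅ : Set B)) ∨ w ∈ (⊤ * {[c]} : Language B))) ↔
    w ∈ lift c s κ ⊤
  constructor
  · rintro ⟨h1, h2⟩
    obtain ⟨l, k, h3, h4, rfl⟩ := exists_joinWith c w
    have hk : k = [] := by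
      rcases h2 with h2 | h2
      · have := List.eq_nil_iff_forall_not_mem.2 fun b hb => (h2 b hb).elim
        exact (List.append_eq_nil_iff.1 this).2
      · obtain ⟨u, -, _, rfl, h5⟩ := Language.mem_mul.1 h2
        rcases List.eq_nil_or_concat k with rfl | ⟨k', b, rfl⟩
        · rfl
        · rw [List.concat_eq_append, ← List.append_assoc] at h5
          have := List.append_inj_right' h5 rfl
          simp at this
          subst this
          simp at h4
    subst hk
    refine ⟨l, fun k hk b hb => ⟨h1 b ?_, ?_⟩, by simp, trivial⟩
    · simpa using mem_joinWith.2 ⟨k, hk, Or.inl hb⟩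
    · rintro rfl
      exact h3 k hk hb
  · rintro ⟨l, hl, rfl, -⟩
    refine ⟨fun b hb => ?_, ?_⟩
    · obtain ⟨k, hk, hb | rfl⟩ := mem_joinWith.1 hb
      · exact (hl k hk b hb).1
      · exact hc
    · rcases List.eq_nil_or_concat l with rfl | ⟨l', k, rfl⟩
      · exact Or.inl (by simp [joinWith])
      · right
        refine Language.mem_mul.2 ⟨joinWith c l' ++ k, trivial, [c], rfl, ?_⟩
        simp [joinWith]

/-- The factorization into blocks `kᵢ c` is unique, so `lift` commutes with the Boolean operations
(complements being relative to `lift c s κ ⊤`) and with concatenation. Only the generators need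
work: a letter `t` lifts to a single block, and a fibre over `G` to a fibre. -/
theorem starFree_lift {B S G : Type*} [Finite B] [Monoid S] [Group G] {π : S →* G}
    {f : B → S} {c : B} {s : Set B} (hc : c ∈ s) {κ : List B → S}
    (hκ : ∀ t, InStarFreeClosure (fiberClass π f)
      ({w | (∀ b ∈ w, b ∈ s \ {c}) ∧ κ w = t} : Language B))
    (hπ : ∀ w : List B, (∀ b ∈ w, b ∈ s \ {c}) → π (wordValue f w) = π (κ w))
    {U : Language S}
    (hU : InStarFreeClosure
      (fiberClass (LocalMonoid.hom π (f c)) (LocalMonoid.conj (f c))) U) :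
    InStarFreeClosure (fiberClass π f) (lift c s κ U) := by
  induction hU with
  | base U hU =>
    obtain ⟨g, rfl⟩ := hU
    refine (InStarFreeClosure.inter _ _ (lift_top π f hc κ)
      (starFree_fiber π f ((π (f c))⁻¹ * g * π (f c)))).of_eq fun w => ?_
    -- The word is a product of factors `kᵢ c`, while its image in the local monoid is mapped to a
    -- product of factors `π (f c) * π (κ kᵢ)`: the two group values are conjugate by `π (f c)`.
    have key : ∀ l : List (List B), (∀ k ∈ l, ∀ b ∈ k, b ∈ s \ {c}) →
        π (wordValue f (joinWith c l)) = (π (f c))⁻¹ *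
          LocalMonoid.hom π (f c) (wordValue (LocalMonoid.conj (f c)) (l.map κ)) * π (f c) := by
      intro l
      induction l with
      | nil => intro _; simp [joinWith, wordValue]
      | cons k l ih =>
        intro hl
        rw [joinWith_cons, wordValue_append, wordValue_cons, List.map_cons, wordValue_cons,
          map_mul, map_mul, map_mul, ih fun k hk => hl k (by simp [hk]), hπ k (hl k (by simp)),
          LocalMonoid.hom_apply π (LocalMonoid.conj _ _), LocalMonoid.val_conj]
        simp [mul_assoc]
    constructor
    · rintro ⟨⟨l, hl, rfl, -⟩, h2⟩
      refine ⟨l, hl, rfl, ?_⟩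
      change π (wordValue f (joinWith c l)) = _ at h2
      rw [key l hl] at h2
      exact mul_left_cancel (mul_right_cancel h2)
    · rintro ⟨l, hl, rfl, h2⟩
      refine ⟨⟨l, hl, rfl, trivial⟩, ?_⟩
      change π (wordValue f (joinWith c l)) = _
      rw [key l hl]
      exact congrArg (fun x => (π (f c))⁻¹ * x * π (f c)) h2
  | letter t =>
    refine (InStarFreeClosure.concat _ _ (hκ t) (.letter c)).of_eq fun w => ?_
    constructor
    · intro hw
      obtain ⟨k, ⟨hk, rfl⟩, _, rfl, rfl⟩ := Language.mem_mul.1 hw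
      exact ⟨[k], by simpa using hk, by simp [joinWith], rfl⟩
    · rintro ⟨l, hl, rfl, h⟩
      change l.map κ = [t] at h
      obtain ⟨k, rfl, rfl⟩ := List.map_eq_singleton_iff.1 h
      exact Language.mem_mul.2 ⟨k, ⟨by simpa using hl, rfl⟩, [c], rfl, by simp [joinWith]⟩
  | union U V _ _ hU hV =>
    refine (InStarFreeClosure.union _ _ hU hV).of_eq fun w => ?_
    constructor
    · rintro (⟨l, hl, rfl, h⟩ | ⟨l, hl, rfl, h⟩)
      · exact ⟨l, hl, rfl, Or.inl h⟩
      · exact ⟨l, hl, rfl, Or.inr h⟩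
    · rintro ⟨l, hl, rfl, h | h⟩
      · exact Or.inl ⟨l, hl, rfl, h⟩
      · exact Or.inr ⟨l, hl, rfl, h⟩
  | inter U V _ _ hU hV =>
    refine (InStarFreeClosure.inter _ _ hU hV).of_eq fun w => ?_
    constructor
    · rintro ⟨⟨l, hl, rfl, h⟩, h'⟩
      exact ⟨l, hl, rfl, h, map_mem_of_mem_lift hl h'⟩
    · rintro ⟨l, hl, rfl, h, h'⟩
      exact ⟨⟨l, hl, rfl, h⟩, ⟨l, hl, rfl, h'⟩⟩
  | compl U _ hU =>
    refine (InStarFreeClosure.inter _ _ (lift_top π f hc κ) (.compl _ hU)).of_eq fun w => ?_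
    constructor
    · rintro ⟨⟨l, hl, rfl, -⟩, h'⟩
      exact ⟨l, hl, rfl, fun h => h' ⟨l, hl, rfl, h⟩⟩
    · rintro ⟨l, hl, rfl, h⟩
      exact ⟨⟨l, hl, rfl, trivial⟩, fun h' => h (map_mem_of_mem_lift hl h')⟩
  | concat U V _ _ hU hV =>
    refine (InStarFreeClosure.concat _ _ hU hV).of_eq fun w => ?_
    constructor
    · intro hw
      obtain ⟨_, ⟨l, hl, rfl, h⟩, _, ⟨l', hl', rfl, h'⟩, rfl⟩ := Language.mem_mul.1 hw
      refine ⟨l ++ l', fun k hk => ?_, by rw [joinWith_append], ?_⟩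
      · rcases List.mem_append.1 hk with hk | hk
        · exact hl k hk
        · exact hl' k hk
      · rw [List.map_append]
        exact Language.append_mem_mul h h'
    · rintro ⟨l, hl, rfl, h⟩
      obtain ⟨u, hu, v, hv, huv⟩ := Language.mem_mul.1 h
      obtain ⟨l₁, l₂, rfl, rfl, rfl⟩ := List.map_eq_append_iff.1 huv.symm
      exact Language.mem_mul.2 ⟨_, ⟨l₁, fun k hk => hl k (by simp [hk]), rfl, hu⟩, _,
        ⟨l₂, fun k hk => hl k (by simp [hk]), rfl, hv⟩, (joinWith_append c l₁ l₂).symm⟩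

/-- A word over `s` either avoids `c` or is `k c (k₁ c ⋯ kₙ c) k'` with blocks avoiding `c`. The
outer blocks are bounded by the partition for `s \ {c}`. The middle part becomes a word over the
alphabet `S`, which the partition for the local monoid at `f c` bounds. -/
theorem hasBoundedPartition_step {B S G : Type*} [Finite B] [Monoid S] [Finite S] [Group G]
    {π : S →* G} {le : S → S → Prop} (h : IsSaturatedOrder π le) (f : B → S) {s : Set B} {c : B}
    (hc : c ∈ s) (h1 : HasBoundedPartition π le f (s \ {c}))
    (h2 : HasBoundedPartition (LocalMonoid.hom π (f c)) (fun z w => le z.val w.val)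
      (LocalMonoid.conj (f c)) Set.univ) :
    HasBoundedPartition π le f s := by
  classical
  obtain ⟨κ, hκ, hκb⟩ := h1
  obtain ⟨κ', hκ', hκb'⟩ := h2
  have hne := fiberClass_nonempty π f
  let K₁ : S → Language B := fun t => {w | (∀ b ∈ w, b ∈ s \ {c}) ∧ κ w = t}
  let K₂ : LocalMonoid (f c) → Language B := fun r => lift c s κ {v | κ' v = r}
  have hK₂ : ∀ r, InStarFreeClosure (fiberClass π f) (K₂ r) := fun r =>
    starFree_lift hc hκ (fun w hw => h.map_eq _ _ (hκb w hw)) <|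
      (hκ' r).of_eq fun v => ⟨fun hv => hv.2, fun hv => ⟨fun _ _ => trivial, hv⟩⟩
  let K : S ⊕ (S × LocalMonoid (f c) × S) → Language B :=
    Sum.elim K₁ fun x => K₁ x.1 * {[c]} * K₂ x.2.1 * K₁ x.2.2
  -- The first occurrence of `c` is not a separate factor of the bound: an element of the local
  -- monoid already begins with `f c`.
  let b : S ⊕ (S × LocalMonoid (f c) × S) → S :=
    Sum.elim id fun x => x.1 * x.2.1.val * x.2.2
  have hval : ∀ l : List (List B), (∀ k ∈ l, ∀ b ∈ k, b ∈ s \ {c}) →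
      le (f c * wordValue f (joinWith c l))
        (wordValue (LocalMonoid.conj (f c)) (l.map κ)).val := by
    intro l
    induction l with
    | nil => intro _; simpa [joinWith, wordValue, LocalMonoid.val_one] using h.refl _
    | cons k l ih =>
      intro hl
      rw [joinWith_cons, List.map_cons, wordValue_cons, LocalMonoid.val_conj_mul,
        wordValue_append, wordValue_cons, ← mul_assoc]
      exact h.mul _ _ _ _ (h.mul _ _ _ _ (h.refl _) (hκb k (hl k (by simp))))
        (ih fun k hk => hl k (by simp [hk]))
  have hb : ∀ i, ∀ w ∈ K i, le (wordValue f w) (b i) := by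
    rintro (t | ⟨t, r, t'⟩) w hw
    · obtain ⟨hw, rfl⟩ := hw
      exact hκb w hw
    · obtain ⟨_, hw₁, k', ⟨hk', hkt'⟩, rfl⟩ := Language.mem_mul.1 hw
      obtain ⟨_, hw₂, _, ⟨l, hl, rfl, hr⟩, rfl⟩ := Language.mem_mul.1 hw₁
      obtain ⟨k, ⟨hk, hkt⟩, _, rfl, rfl⟩ := Language.mem_mul.1 hw₂
      change κ' _ = r at hr
      change κ k = t at hkt
      change κ k' = t' at hkt'
      subst hr hkt hkt'
      rw [wordValue_append, wordValue_append, wordValue_append, mul_assoc (wordValue f k)]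
      refine h.mul _ _ _ _ (h.mul _ _ _ _ (hκb k hk) ?_) (hκb k' hk')
      rw [wordValue_cons, wordValue_nil, mul_one]
      exact h.trans _ _ _ (hval l hl) (hκb' _ fun _ _ => trivial)
  have hcov : ∀ w : List B, (∀ b ∈ w, b ∈ s) ↔ ∃ i, w ∈ K i := by
    intro w
    constructor
    · intro hw
      obtain ⟨l, k', hl, hk', rfl⟩ := exists_joinWith c w
      have hk'' : ∀ b ∈ k', b ∈ s \ {c} := fun b hb =>
        ⟨hw b (by simp [hb]), by rintro rfl; exact hk' ‹_›⟩
      have hl' : ∀ k ∈ l, ∀ b ∈ k, b ∈ s \ {c} := fun k hk b hb =>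
        ⟨hw b (List.mem_append_left _ (mem_joinWith.2 ⟨k, hk, Or.inl hb⟩)),
          by rintro rfl; exact hl k hk ‹_›⟩
      cases l with
      | nil => exact ⟨Sum.inl (κ k'), by simpa [joinWith] using hk'', rfl⟩
      | cons k l =>
        refine ⟨Sum.inr (κ k, κ' (l.map κ), κ k'), Language.mem_mul.2 ⟨_, Language.mem_mul.2
          ⟨k ++ [c], Language.mem_mul.2 ⟨k, ⟨hl' k (by simp), rfl⟩, [c], rfl, rfl⟩, joinWith c l,
            ⟨l, fun k hk => hl' k (by simp [hk]), rfl, rfl⟩, rfl⟩, k', ⟨hk'', rfl⟩, ?_⟩⟩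
        simp [joinWith_cons]
    · rintro ⟨t | ⟨t, r, t'⟩, hw⟩
      · exact fun b hb => (hw.1 b hb).1
      · obtain ⟨_, hw₁, k', ⟨hk', -⟩, rfl⟩ := Language.mem_mul.1 hw
        obtain ⟨_, hw₂, _, ⟨l, hl, rfl, -⟩, rfl⟩ := Language.mem_mul.1 hw₁
        obtain ⟨k, ⟨hk, -⟩, _, rfl, rfl⟩ := Language.mem_mul.1 hw₂
        intro b hb
        simp only [List.mem_append, List.mem_singleton, mem_joinWith] at hb
        rcases hb with ((hb | rfl) | ⟨j, hj, hb | rfl⟩) | hb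
        · exact (hk b hb).1
        · exact hc
        · exact (hl j hj b hb).1
        · exact hc
        · exact (hk' b hb).1
  have hK : ∀ i, InStarFreeClosure (fiberClass π f) (K i) := by
    rintro (t | ⟨t, r, t'⟩)
    · exact hκ t
    · exact .concat _ _ (.concat _ _ (.concat _ _ (hκ t) (.letter c)) (hK₂ r)) (hκ t')
  have := Fintype.ofFinite (S ⊕ (S × LocalMonoid (f c) × S))
  obtain ⟨μ, h3, h4⟩ := exists_partition_of_cover hne (fun w t => le (wordValue f w) t) K hK b hb
    1 Finset.univ
  refine ⟨μ, fun t => (h3 t).of_eq fun w => ?_, fun w hw => h4 w (by simpa using (hcov w).1 hw)⟩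
  change ((∃ i ∈ Finset.univ, w ∈ K i) ∧ μ w = t) ↔ (∀ b ∈ w, b ∈ s) ∧ μ w = t
  rw [hcov w]
  simp

-- Induction on the size of `S`, and for fixed `S` on the number of letters. A letter with non-unit
-- value is removed from the alphabet on one side and traded for a smaller local monoid on the
-- other. The recursive call uses `S` itself as alphabet, whence the common universe of `B` and `S`.
universe u v in
theorem IsSaturatedOrder.hasBoundedPartition (n : ℕ) : ∀ {S : Type u} {G : Type v} [Monoid S]
    [Finite S] [Group G] {π : S →* G} {le : S → S → Prop}, IsSaturatedOrder π le →
    Nat.card S = n → ∀ {B : Type u} [Finite B] (f : B → S) (s : Set B), HasBoundedPartition π le f s := by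
  induction n using Nat.strong_induction_on with
  | _ n ihn =>
    intro S G _ _ _ π le h hn B _ f s
    induction hm : s.ncard using Nat.strong_induction_on generalizing s with
    | _ m ihm =>
      subst hm
      by_cases hs : ∀ b ∈ s, IsUnit (f b)
      · exact hasBoundedPartition_of_units h f s hs
      · push Not at hs
        obtain ⟨c, hc, hcu⟩ := hs
        refine hasBoundedPartition_step h f hc (ihm _ ?_ _ rfl) ?_
        · exact Set.ncard_sdiff_singleton_lt_of_mem hc (Set.toFinite s)
        · subst hn
          exact ihn _ (LocalMonoid.card_lt hcu) (LocalMonoid.isSaturatedOrder h (f c)) rfl _ _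

/-! ### Morphisms to finite groups whose fibres belong to a class -/

namespace IsQuotientClosedBooleanAlgebra

variable {A : Type*} {C : Set (Language A)}

theorem top_mem (hC : IsQuotientClosedBooleanAlgebra C) : (⊤ : Language A) ∈ C := by
  obtain ⟨L, hL⟩ := hC.nonempty
  have : L ⊔ Lᶜ = ⊤ := sup_compl_eq_top
  exact this ▸ hC.union_mem _ hL _ (hC.compl_mem _ hL)

theorem bot_mem (hC : IsQuotientClosedBooleanAlgebra C) : (⊥ : Language A) ∈ C := by
  have : (⊤ : Language A)ᶜ = ⊥ := compl_top
  exact this ▸ hC.compl_mem _ hC.top_mem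

theorem forall_mem (hC : IsQuotientClosedBooleanAlgebra C) {D : Set (Language A)}
    (hD : D.Finite) (h : D ⊆ C) : ({w | ∀ L ∈ D, w ∈ L} : Language A) ∈ C := by
  induction D, hD using Set.Finite.induction_on with
  | empty =>
    have : ({w | ∀ L ∈ (∅ : Set (Language A)), w ∈ L} : Language A) = ⊤ :=
      Set.ext fun w => ⟨fun _ => trivial, fun _ L hL => hL.elim⟩
    exact this ▸ hC.top_mem
  | @insert L D _ _ ih =>
    have : ({w | ∀ L' ∈ insert L D, w ∈ L'} : Language A) = L ⊓ {w | ∀ L' ∈ D, w ∈ L'} :=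
      Set.ext fun w => ⟨fun hw => ⟨hw L (Set.mem_insert _ _), fun L' hL' =>
        hw L' (Set.mem_insert_of_mem _ hL')⟩, fun hw L' hL' => by
          rcases hL' with rfl | hL'
          · exact hw.1
          · exact hw.2 L' hL'⟩
    rw [this]
    exact hC.inter_mem _ (h (Set.mem_insert _ _)) _ (ih fun L' hL' =>
      h (Set.mem_insert_of_mem _ hL'))

theorem quotient_mem (hC : IsQuotientClosedBooleanAlgebra C) {L : Language A} (hL : L ∈ C)
    (u v : List A) : ({w | u ++ w ++ v ∈ L} : Language A) ∈ C := by
  have := hC.leftQuotient_mem _ (hC.rightQuotient_mem _ hL v) u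
  exact this

theorem quotient_iff_mem (hC : IsQuotientClosedBooleanAlgebra C) {L : Language A} (hL : L ∈ C)
    (u v : List A) (p : Prop) : ({w | u ++ w ++ v ∈ L ↔ p} : Language A) ∈ C := by
  have h := hC.quotient_mem hL u v
  by_cases hp : p
  · simpa [hp] using h
  · have := hC.compl_mem _ h
    have h' : ({w | u ++ w ++ v ∈ L ↔ p} : Language A) = {w | u ++ w ++ v ∈ L}ᶜ :=
      Set.ext fun w => ⟨fun hw hw' => hp (hw.1 hw'), fun hw => ⟨fun h => (hw h).elim,
        fun h => (hp h).elim⟩⟩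
    rw [h']
    exact this

end IsQuotientClosedBooleanAlgebra

/-- All fibres of the morphism that extends `f` belong to `C`. -/
def IsClassMorphism {A G : Type*} [Monoid G] (C : Set (Language A)) (f : A → G) : Prop :=
  ∀ g, ({w | wordValue f w = g} : Language A) ∈ C

theorem IsQuotientClosedBooleanAlgebra.isClassMorphism_one {A : Type*} {C : Set (Language A)}
    (hC : IsQuotientClosedBooleanAlgebra C) : IsClassMorphism C fun _ : A => (1 : PUnit) := by
  intro g
  have : ({w | wordValue (fun _ : A => (1 : PUnit)) w = g} : Language A) = ⊤ :=
    Set.ext fun w => ⟨fun _ => trivial, fun _ => Subsingleton.elim (α := PUnit) _ _⟩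
  exact this ▸ hC.top_mem

theorem wordValue_prod {A M N : Type*} [Monoid M] [Monoid N] (f : A → M) (g : A → N)
    (w : List A) : wordValue (fun a => (f a, g a)) w = (wordValue f w, wordValue g w) := by
  induction w with
  | nil => rfl
  | cons a w ih => simp [wordValue_cons, ih]

theorem IsClassMorphism.prod {A G H : Type*} [Monoid G] [Monoid H] {C : Set (Language A)}
    (hC : IsQuotientClosedBooleanAlgebra C) {f : A → G} {g : A → H} (hf : IsClassMorphism C f)
    (hg : IsClassMorphism C g) : IsClassMorphism C fun a => (f a, g a) := by
  rintro ⟨x, y⟩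
  have : ({w | wordValue (fun a => (f a, g a)) w = (x, y)} : Language A) =
      {w | wordValue f w = x} ⊓ {w | wordValue g w = y} := Set.ext fun w => by
    change wordValue (fun a => (f a, g a)) w = (x, y) ↔ wordValue f w = x ∧ wordValue g w = y
    rw [wordValue_prod, Prod.mk.injEq]
  rw [this]
  exact hC.inter_mem _ (hf x) _ (hg y)

/-- The syntactic congruence of a language. -/
def syntacticCon {A : Type*} (L : Language A) : Con (FreeMonoid A) where
  r w w' := ∀ u v : List A, u ++ w.toList ++ v ∈ L ↔ u ++ w'.toList ++ v ∈ L
  iseqv := ⟨fun _ _ _ => Iff.rfl, fun h u v => (h u v).symm, fun h h' u v => (h u v).trans (h' u v)⟩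
  mul' {w x y z} h h' u v := by
    have h1 := h u (y.toList ++ v)
    have h2 := h' (u ++ x.toList) v
    simp only [FreeMonoid.toList_mul, List.append_assoc] at h1 h2 ⊢
    exact h1.trans h2

theorem syntacticCon_iff {A : Type*} {L : Language A} {w w' : FreeMonoid A} :
    syntacticCon L w w' ↔
      ∀ u v : List A, u ++ w.toList ++ v ∈ L ↔ u ++ w'.toList ++ v ∈ L := Iff.rfl

-- The syntactic monoid of a group language is a finite group, and each of its classes is cut out by
-- conditions on finitely many two-sided quotients of `L`, hence belongs to `C`.
universe u in
theorem exists_classMorphism {A : Type u} {C : Set (Language A)}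
    (hC : IsQuotientClosedBooleanAlgebra C) (hgroup : ∀ L ∈ C, IsGroupLanguage L)
    {L : Language A} (hL : L ∈ C) :
    ∃ (G : Type u) (_ : Group G) (_ : Finite G) (f : A → G), IsClassMorphism C f ∧
      ∀ w w', wordValue f w = wordValue f w' → (w ∈ L ↔ w' ∈ L) := by
  obtain ⟨H, _, _, α, P, hα⟩ := hgroup L hL
  have hcon : ∀ w w' : FreeMonoid A, α w = α w' → syntacticCon L w w' := by
    intro w w' h u v
    rw [hα, hα]
    simp [FreeMonoid.ofList_append, h]
  have hunit : ∀ q : (syntacticCon L).Quotient, IsUnit q := by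
    intro q
    induction q using Con.induction_on with
    | H w =>
      -- In `H` the power with exponent `Nat.card H` is trivial, and equality in `H` implies
      -- syntactic equivalence.
      refine IsUnit.of_pow_eq_one (n := Nat.card H) ?_ Nat.card_pos.ne'
      have h1 : syntacticCon L (w ^ Nat.card H) 1 :=
        hcon _ _ (by rw [map_pow, pow_card_eq_one', map_one])
      exact (Con.eq _).2 h1
  let _ : Group (syntacticCon L).Quotient := groupOfIsUnit hunit
  have hfin : Finite (syntacticCon L).Quotient := by
    refine Finite.of_injective (fun q => α (Quotient.out q)) fun q q' h => ?_
    rw [← Quotient.out_eq q, ← Quotient.out_eq q']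
    exact Quotient.sound (hcon _ _ h)
  let f : A → (syntacticCon L).Quotient := fun a => (FreeMonoid.of a : FreeMonoid A)
  have hf : ∀ w, wordValue f w = ((FreeMonoid.ofList w : FreeMonoid A) :
      (syntacticCon L).Quotient) := by
    intro w
    induction w with
    | nil => rfl
    | cons a w ih => rw [wordValue_cons, ih, FreeMonoid.ofList_cons, Con.coe_mul]
  refine ⟨_, inferInstance, hfin, f, fun g => ?_, fun w w' h => ?_⟩
  · induction g using Con.induction_on with
    | H w₀ =>
      let D : List A × List A → Language A := fun x =>
        {w | x.1 ++ w ++ x.2 ∈ L ↔ x.1 ++ w₀.toList ++ x.2 ∈ L}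
      -- A quotient by `u` and `v` depends only on the images of `u` and `v` in `H`.
      have hfinD : (Set.range D).Finite := by
        refine (Set.finite_range fun x : H × H => ({w | x.1 * α (FreeMonoid.ofList w) * x.2 ∈ P ↔
          x.1 * α w₀ * x.2 ∈ P} : Language A)).subset ?_
        rintro _ ⟨⟨u, v⟩, rfl⟩
        refine ⟨(α (FreeMonoid.ofList u), α (FreeMonoid.ofList v)), Set.ext fun w => ?_⟩
        change (_ ↔ _) ↔ (u ++ w ++ v ∈ L ↔ u ++ w₀.toList ++ v ∈ L)
        rw [hα, hα]
        simp [FreeMonoid.ofList_append, mul_assoc]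
      have := hC.forall_mem hfinD (by
        rintro _ ⟨⟨u, v⟩, rfl⟩
        exact hC.quotient_iff_mem hL u v _)
      convert this using 1
      refine Set.ext fun w => ?_
      change wordValue f w = _ ↔ ∀ L' ∈ Set.range D, w ∈ L'
      rw [hf, Con.eq, syntacticCon_iff, Set.forall_mem_range, Prod.forall]
      rfl
  · rw [hf, hf, Con.eq, syntacticCon_iff] at h
    simpa using h [] []

/-! ### Pumping in star-free closures -/

/-- The `n`-th power of a word. -/
def wordPow {A : Type*} (w : List A) (n : ℕ) : List A := (List.replicate n w).flatten

theorem wordPow_zero {A : Type*} (w : List A) : wordPow w 0 = [] := rfl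

theorem wordPow_succ {A : Type*} (w : List A) (n : ℕ) : wordPow w (n + 1) = w ++ wordPow w n := by
  simp [wordPow, List.replicate_succ]

theorem wordPow_add {A : Type*} (w : List A) (m n : ℕ) :
    wordPow w (m + n) = wordPow w m ++ wordPow w n := by
  simp [wordPow, ← List.replicate_append_replicate]

theorem wordPow_add_one {A : Type*} (w : List A) (n : ℕ) :
    wordPow w (n + 1) = wordPow w n ++ w := by
  rw [wordPow_add, wordPow_succ w 0, wordPow_zero, List.append_nil]

theorem wordValue_wordPow {A M : Type*} [Monoid M] (f : A → M) (w : List A) (n : ℕ) :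
    wordValue f (wordPow w n) = wordValue f w ^ n := by
  induction n with
  | zero => simp [wordPow_zero, wordValue_nil]
  | succ n ih => rw [wordPow_succ, wordValue_append, ih, pow_succ']

/-- A cut of a nonempty power always falls within one copy `p ++ q` of `w`, possibly at its end. -/
theorem wordPow_eq_append {A : Type*} {w x y : List A} {n : ℕ} (hn : n ≠ 0)
    (h : wordPow w n = x ++ y) :
    ∃ i j p q, i + j + 1 = n ∧ w = p ++ q ∧ x = wordPow w i ++ p ∧ y = q ++ wordPow w j := by
  induction n generalizing x with
  | zero => exact absurd rfl hn
  | succ n ih =>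
    rw [wordPow_succ, List.append_eq_append_iff] at h
    rcases h with ⟨z, rfl, hz⟩ | ⟨z, hw, rfl⟩
    · rcases Nat.eq_zero_or_pos n with rfl | hn
      · obtain ⟨rfl, rfl⟩ := List.append_eq_nil_iff.1 hz.symm
        exact ⟨0, 0, w, [], rfl, by simp, by simp [wordPow_zero], by simp [wordPow_zero]⟩
      · obtain ⟨i, j, p, q, h1, h2, h3, h4⟩ := ih hn.ne' hz
        exact ⟨i + 1, j, p, q, by omega, h2, by rw [h3, wordPow_succ, List.append_assoc], h4⟩
    · exact ⟨0, n, x, z, by omega, hw, by simp [wordPow_zero], rfl⟩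

/-- The membership of `u wⁿ v` in `K` does not depend on `n ≥ k`, if `w` has the value `1`. -/
def PumpedBy {A G : Type*} [Monoid G] (f : A → G) (k : ℕ) (K : Language A) : Prop :=
  ∀ w, wordValue f w = 1 → ∀ u v : List A, ∀ m ≥ k, ∀ n ≥ k,
    u ++ wordPow w m ++ v ∈ K → u ++ wordPow w n ++ v ∈ K

theorem PumpedBy.fst {A G H : Type*} [Monoid G] [Monoid H] {f : A → G} {k : ℕ}
    {K : Language A} (h : PumpedBy f k K) (g : A → H) {k' : ℕ} (hk : k ≤ k') :
    PumpedBy (fun a => (f a, g a)) k' K := by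
  intro w hw u v m hm n hn
  rw [wordValue_prod] at hw
  exact h w (congrArg Prod.fst hw) u v m (hk.trans hm) n (hk.trans hn)

theorem PumpedBy.snd {A G H : Type*} [Monoid G] [Monoid H] {f : A → G} {k : ℕ}
    {K : Language A} (h : PumpedBy f k K) (g : A → H) {k' : ℕ} (hk : k ≤ k') :
    PumpedBy (fun a => (g a, f a)) k' K := by
  intro w hw u v m hm n hn
  rw [wordValue_prod] at hw
  exact h w (congrArg Prod.snd hw) u v m (hk.trans hm) n (hk.trans hn)

/-- A cut inside `w ^ m` leaves `i` full copies to the left and `j` to the right, with `i + j + 1 =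
m`. If `m ≥ k + l + 1`, then `i ≥ k` or `j ≥ l`, so at least one side can be pumped. -/
theorem PumpedBy.mul {A G : Type*} [Monoid G] {f : A → G} {k l : ℕ} {K L : Language A}
    (hK : PumpedBy f k K) (hL : PumpedBy f l L) : PumpedBy f (k + l + 1) (K * L) := by
  intro w hw u v m hm n hn h
  obtain ⟨x, hx, y, hy, hxy⟩ := Language.mem_mul.1 h
  rw [List.append_assoc, List.append_eq_append_iff] at hxy
  rcases hxy with ⟨z, rfl, rfl⟩ | ⟨z, rfl, hz⟩
  · refine Language.mem_mul.2 ⟨x, hx, z ++ wordPow w n ++ v, hL w hw z v m (by omega) n (by omega)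
      (by simpa using hy), by simp⟩
  · rw [eq_comm, List.append_eq_append_iff] at hz
    rcases hz with ⟨z', hz, rfl⟩ | ⟨z', rfl, rfl⟩
    · obtain ⟨i, j, p, q, h1, h2, rfl, rfl⟩ := wordPow_eq_append (by omega) hz
      have key : ∀ i' j', i' + j' + 1 = n → u ++ wordPow w i' ++ p ∈ K →
          q ++ wordPow w j' ++ v ∈ L → u ++ wordPow w n ++ v ∈ K * L := by
        intro i' j' hij hx' hy'
        refine Language.mem_mul.2 ⟨_, hx', _, hy', ?_⟩
        have : wordPow w n = wordPow w i' ++ (p ++ q) ++ wordPow w j' := by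
          rw [← h2, ← hij, add_right_comm, wordPow_add, wordPow_add_one]
        rw [this]
        simp
      have hx' : u ++ wordPow w i ++ p ∈ K := by simpa using hx
      -- A side with too few copies keeps its number and the other side absorbs the change. If both
      -- can be pumped, `k` copies go to the left and the rest to the right.
      by_cases hi : i < k
      · exact key i (n - 1 - i) (by omega) hx' (hL w hw q v j (by omega) _ (by omega) hy)
      · by_cases hj : j < l
        · exact key (n - 1 - j) j (by omega) (hK w hw u p i (by omega) _ (by omega) hx') hy
        · exact key k (n - 1 - k) (by omega) (hK w hw u p i (by omega) _ (by omega) hx')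
            (hL w hw q v j (by omega) _ (by omega) hy)
    · refine Language.mem_mul.2 ⟨u ++ wordPow w n ++ z', hK w hw u z' m (by omega) n (by omega)
        (by simpa using hx), y, hy, by simp⟩

-- This replaces aperiodicity of star-free languages: powers stabilize only for words that are
-- trivial in a group all of whose fibres lie in `C`. Products of groups combine the data of two
-- languages.
universe u in
theorem exists_pumpedBy {A : Type u} {C : Set (Language A)}
    (hC : IsQuotientClosedBooleanAlgebra C) (hgroup : ∀ L ∈ C, IsGroupLanguage L)
    {K : Language A} (hK : InStarFreeClosure C K) :
    ∃ (G : Type u) (_ : Group G) (f : A → G) (k : ℕ), IsClassMorphism C f ∧ PumpedBy f k K := by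
  induction hK with
  | base L hL =>
    obtain ⟨G, _, _, f, hf, hfL⟩ := exists_classMorphism hC hgroup hL
    refine ⟨G, inferInstance, f, 0, hf, fun w hw u v m _ n _ h => (hfL _ _ ?_).1 h⟩
    simp [wordValue_append, wordValue_wordPow, hw]
  | letter a =>
    -- From exponent `2` on, a power inside a one-letter word is a power of the empty word.
    refine ⟨PUnit, inferInstance, fun _ => 1, 2, hC.isClassMorphism_one,
      fun w _ u v m hm n hn h => ?_⟩
    · have hw : w = [] := by
        change u ++ wordPow w m ++ v = [a] at h
        obtain ⟨m, rfl⟩ := Nat.exists_eq_add_of_le' hm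
        have := congrArg List.length h
        simp only [List.length_append, wordPow_succ, List.length_singleton] at this
        exact List.eq_nil_of_length_eq_zero (by omega)
      have hnil : ∀ n, wordPow w n = [] := fun n => by simp [wordPow, hw]
      rw [hnil] at h ⊢
      exact h
  | union K L _ _ hK hL =>
    obtain ⟨G, _, f, k, hf, hfK⟩ := hK
    obtain ⟨H, _, g, l, hg, hgL⟩ := hL
    refine ⟨G × H, inferInstance, fun a => (f a, g a), k + l, hf.prod hC hg, ?_⟩
    intro w hw u v m hm n hn h
    exact h.imp (hfK.fst g (by omega) w hw u v m hm n hn) (hgL.snd f (by omega) w hw u v m hm n hn)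
  | inter K L _ _ hK hL =>
    obtain ⟨G, _, f, k, hf, hfK⟩ := hK
    obtain ⟨H, _, g, l, hg, hgL⟩ := hL
    refine ⟨G × H, inferInstance, fun a => (f a, g a), k + l, hf.prod hC hg, ?_⟩
    intro w hw u v m hm n hn h
    exact ⟨hfK.fst g (by omega) w hw u v m hm n hn h.1,
      hgL.snd f (by omega) w hw u v m hm n hn h.2⟩
  | compl K _ hK =>
    obtain ⟨G, _, f, k, hf, hfK⟩ := hK
    exact ⟨G, inferInstance, f, k, hf, fun w hw u v m hm n hn h h' =>
      h (hfK w hw u v n hn m hm h')⟩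
  | concat K L _ _ hK hL =>
    obtain ⟨G, _, f, k, hf, hfK⟩ := hK
    obtain ⟨H, _, g, l, hg, hgL⟩ := hL
    exact ⟨G × H, inferInstance, fun a => (f a, g a), k + l + 1, hf.prod hC hg,
      (hfK.fst g le_rfl).mul (hgL.snd f le_rfl)⟩

universe u in
theorem exists_pumpedBy_of_finite {A : Type u} {C : Set (Language A)}
    (hC : IsQuotientClosedBooleanAlgebra C) (hgroup : ∀ L ∈ C, IsGroupLanguage L)
    {D : Set (Language A)} (hfin : D.Finite) (hD : D ⊆ StarFreeClosure C) :
    ∃ (G : Type u) (_ : Group G) (f : A → G) (k : ℕ), IsClassMorphism C f ∧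
      ∀ K ∈ D, PumpedBy f k K := by
  induction D, hfin using Set.Finite.induction_on with
  | empty =>
    exact ⟨PUnit, inferInstance, fun _ => 1, 0, hC.isClassMorphism_one, fun _ h => h.elim⟩
  | @insert K D _ _ ih =>
    obtain ⟨G, _, f, k, hf, hfD⟩ := ih fun L hL => hD (Set.mem_insert_of_mem _ hL)
    obtain ⟨H, _, g, l, hg, hgK⟩ := exists_pumpedBy hC hgroup (hD (Set.mem_insert _ _))
    refine ⟨G × H, inferInstance, fun a => (f a, g a), k + l, hf.prod hC hg, ?_⟩
    rintro L (rfl | hL)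
    · exact hgK.snd f (by omega)
    · exact (hfD L hL).fst g (by omega)

/-! ### Saturated families -/

/-- The products of a member of `F`, the singleton of the value of a letter, a member of `F`, and
so on, along the word `w`. -/
def reach {A M : Type*} [Monoid M] (F : Set (Set M)) (φ : A → M) (w : List A) : Set (Set M) :=
  F * wordValue (fun a => {{φ a}} * F) w

/-- A family of subsets of `M` which is closed under the operations that produce the sets of
elements of `M` which the star-free closure of `C` does not separate. -/
structure IsSaturatedFamily {A M : Type*} [Monoid M] (C : Set (Language A)) (φ : A → M) (N : ℕ)
    (F : Set (Set M)) : Prop where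
  one_mem : {1} ∈ F
  mul_mem : ∀ T ∈ F, ∀ T' ∈ F, T * T' ∈ F
  pow_mem : ∀ T, ¬ Separable C {[]} ({w | T ∈ reach F φ w} : Language A) →
    ∃ U ∈ F, T ^ N ⊆ U ∧ T ^ (N + 1) ⊆ U

theorem IsSaturatedFamily.mul_self {A M : Type*} [Monoid M] {C : Set (Language A)} {φ : A → M}
    {N : ℕ} {F : Set (Set M)} (h : IsSaturatedFamily C φ N F) : F * F = F := by
  apply Set.Subset.antisymm
  · rintro _ ⟨T, hT, T', hT', rfl⟩
    exact h.mul_mem T hT T' hT'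
  · intro T hT
    exact ⟨T, hT, {1}, h.one_mem, by simp⟩

theorem IsSaturatedFamily.reach_mul {A M : Type*} [Monoid M] {C : Set (Language A)} {φ : A → M}
    {N : ℕ} {F : Set (Set M)} (h : IsSaturatedFamily C φ N F) (w w' : List A) :
    reach F φ w * reach F φ w' = reach F φ (w ++ w') := by
  have key : reach F φ w * F = reach F φ w := by
    induction w using List.reverseRecOn with
    | nil => simp [reach, wordValue_nil, h.mul_self]
    | append_singleton w a _ =>
      simp only [reach, wordValue_append, wordValue_cons, wordValue_nil, mul_one, mul_assoc,
        h.mul_self]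
  rw [show reach F φ w' = F * wordValue (fun a => {{φ a}} * F) w' from rfl, ← mul_assoc, key,
    reach, reach, wordValue_append, mul_assoc]

/-- `T` meets `P` and all `Q i`. -/
def Meets {M ι : Type*} (P : Set M) (Q : ι → Set M) (T : Set M) : Prop :=
  (∃ t ∈ T, t ∈ P) ∧ ∀ i, ∃ t ∈ T, t ∈ Q i

/-- Call a set pointed by `w` if all its elements are values of words that have the group value of
`w` and are syntactically equivalent to `w` for every member of the cover. The sets pointed by words
of group value `1` form the family. -/
theorem exists_isSaturatedFamily {A M ι : Type*} [Monoid M] {C : Set (Language A)}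
    (hC : IsQuotientClosedBooleanAlgebra C) (hgroup : ∀ L ∈ C, IsGroupLanguage L) (φ : A → M)
    {N : ℕ} (hN : ∀ (T : Set M) (k : ℕ), ∃ n ≥ k, T ^ n = T ^ N) {L : Language A}
    {L' : ι → Language A} {P : Set M} {Q : ι → Set M} (hP : ∀ w, w ∈ L ↔ wordValue φ w ∈ P)
    (hQ : ∀ i w, w ∈ L' i ↔ wordValue φ w ∈ Q i)
    (hcov : Coverable (StarFreeClosure C) L (Set.range L')) :
    ∃ F, IsSaturatedFamily C φ N F ∧ ∀ w, ∀ T ∈ reach F φ w, ¬ Meets P Q T := by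
  obtain ⟨D, ⟨hfin, hD, hDL⟩, hDL'⟩ := hcov
  obtain ⟨G, _, f, k, hf, hpump⟩ := exists_pumpedBy_of_finite hC hgroup hfin hD
  let R : List A → List A → Prop := fun w w' => wordValue f w = wordValue f w' ∧
    ∀ K ∈ D, ∀ u v : List A, u ++ w ++ v ∈ K ↔ u ++ w' ++ v ∈ K
  have hRrefl : ∀ w, R w w := fun w => ⟨rfl, fun K _ u v => Iff.rfl⟩
  have hRtrans : ∀ w w' w'', R w w' → R w' w'' → R w w'' := fun w w' w'' h h' =>
    ⟨h.1.trans h'.1, fun K hK u v => (h.2 K hK u v).trans (h'.2 K hK u v)⟩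
  have hRmul : ∀ w x y z, R w x → R y z → R (w ++ y) (x ++ z) := by
    intro w x y z h h'
    refine ⟨by rw [wordValue_append, wordValue_append, h.1, h'.1], fun K hK u v => ?_⟩
    have h1 := h.2 K hK u (y ++ v)
    have h2 := h'.2 K hK (u ++ x) v
    simp only [List.append_assoc] at h1 h2 ⊢
    exact h1.trans h2
  let Pt : List A → Set M → Prop := fun w T => ∀ t ∈ T, ∃ x, wordValue φ x = t ∧ R x w
  have hPtmul : ∀ w w' T T', Pt w T → Pt w' T' → Pt (w ++ w') (T * T') := by
    rintro w w' T T' h h' _ ⟨t, ht, t', ht', rfl⟩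
    obtain ⟨x, rfl, hx⟩ := h t ht
    obtain ⟨x', rfl, hx'⟩ := h' t' ht'
    exact ⟨x ++ x', wordValue_append _ _ _, hRmul _ _ _ _ hx hx'⟩
  have hPtpow : ∀ w T n, Pt w T → Pt (wordPow w n) (T ^ n) := by
    intro w T n h
    induction n with
    | zero =>
      rintro t ht
      rw [pow_zero, Set.mem_one] at ht
      exact ⟨[], ht.symm, hRrefl _⟩
    | succ n ih =>
      rw [wordPow_add_one, pow_succ]
      exact hPtmul _ _ _ _ ih h
  let F : Set (Set M) := {T | ∃ w, wordValue f w = 1 ∧ Pt w T}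
  have hreach : ∀ w, ∀ T ∈ reach F φ w, ∃ x, wordValue f x = wordValue f w ∧ Pt x T := by
    have key : ∀ w, ∀ T ∈ wordValue (fun a => {{φ a}} * F) w,
        ∃ x, wordValue f x = wordValue f w ∧ Pt x T := by
      intro w
      induction w with
      | nil =>
        intro T hT
        rw [wordValue_nil, Set.mem_one] at hT
        subst hT
        exact ⟨[], rfl, fun t ht => ⟨[], (Set.mem_one.1 ht).symm, hRrefl _⟩⟩
      | cons a w ih =>
        intro T hT
        rw [wordValue_cons] at hT
        obtain ⟨_, ⟨_, rfl, T₁, ⟨x₁, hx₁, hT₁⟩, rfl⟩, T₂, hT₂, rfl⟩ := hT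
        obtain ⟨x₂, hx₂, hT₂⟩ := ih T₂ hT₂
        refine ⟨[a] ++ x₁ ++ x₂, ?_, hPtmul _ _ _ _ (hPtmul _ _ _ _ ?_ hT₁) hT₂⟩
        · rw [wordValue_append, wordValue_append, hx₁, hx₂]
          simp [wordValue]
        · rintro _ rfl
          exact ⟨[a], by simp [wordValue], hRrefl _⟩
    rintro w _ ⟨T, ⟨x, hx, hT⟩, T', hT', rfl⟩
    obtain ⟨x', hx', hT'⟩ := key w T' hT'
    exact ⟨x ++ x', by rw [wordValue_append, hx, hx', one_mul], hPtmul _ _ _ _ hT hT'⟩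
  refine ⟨F, ⟨?_, ?_, ?_⟩, ?_⟩
  · exact ⟨[], rfl, fun t ht => ⟨[], (Set.mem_singleton_iff.1 ht).symm, hRrefl _⟩⟩
  · rintro T ⟨x, hx, hT⟩ T' ⟨x', hx', hT'⟩
    exact ⟨x ++ x', by rw [wordValue_append, hx, hx', one_mul], hPtmul _ _ _ _ hT hT'⟩
  · intro T hT
    -- Otherwise the kernel of the group morphism, which belongs to `C`, would be a separator.
    have : ∃ w, wordValue f w = 1 ∧ T ∈ reach F φ w := by
      by_contra hne
      push Not at hne
      refine hT ⟨_, hf 1, ?_, ?_⟩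
      · rintro _ rfl
        exact wordValue_nil f
      · exact eq_bot_iff.2 fun w hw => hne w hw.2 hw.1
    obtain ⟨w, hw, hwT⟩ := this
    obtain ⟨x, hx, hxT⟩ := hreach w T hwT
    obtain ⟨n, hn, hTn⟩ := hN T k
    have hx1 : wordValue f x = 1 := hx.trans hw
    -- Since `n ≥ k`, pumping makes `x ^ n` and `x ^ (n + 1)` equivalent, so `x ^ n` points both `T
    -- ^ n = T ^ N` and `T ^ (n + 1) = T ^ (N + 1)`.
    refine ⟨T ^ N ∪ T ^ (N + 1), ⟨wordPow x n, by rw [wordValue_wordPow, hx1, one_pow], ?_⟩,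
      Set.subset_union_left, Set.subset_union_right⟩
    rw [pow_succ, ← hTn, ← pow_succ]
    rintro t (ht | ht)
    · exact hPtpow x T n hxT t ht
    · obtain ⟨y, hy, hyR⟩ := hPtpow x T (n + 1) hxT t ht
      refine ⟨y, hy, hRtrans _ _ _ hyR ⟨?_, fun K hK u v => ⟨?_, ?_⟩⟩⟩
      · rw [wordValue_wordPow, wordValue_wordPow, hx1, one_pow, one_pow]
      · exact hpump K hK x hx1 u v _ (by omega) _ hn
      · exact hpump K hK x hx1 u v _ hn _ (by omega)
  · rintro w T hT ⟨⟨t, ht, htP⟩, h'⟩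
    obtain ⟨x, -, hx⟩ := hreach w T hT
    obtain ⟨y, rfl, hy⟩ := hx t ht
    -- A pointed set that meets everything gives equivalent words, one in `L` and one in each `L'
    -- i`. They all lie in the same member `H` of the cover, which is disjoint from some `L' i`.
    obtain ⟨H, hH, hyH⟩ := hDL y ((hP y).2 htP)
    obtain ⟨_, ⟨i, rfl⟩, hi⟩ := hDL' H hH
    obtain ⟨t', ht', htQ⟩ := h' i
    obtain ⟨z, rfl, hz⟩ := hx t' ht'
    have hzH : z ∈ H := by
      have h1 := hy.2 H hH [] []
      have h2 := hz.2 H hH [] []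
      simp only [List.nil_append, List.append_nil] at h1 h2
      exact h2.2 (h1.1 hyH)
    have : z ∈ (⊥ : Language A) := hi ▸ (⟨hzH, (hQ i z).2 htQ⟩ : z ∈ H ⊓ L' i)
    exact this

theorem wordValue_singleton {A M : Type*} [Monoid M] (φ : A → M) (w : List A) :
    wordValue (fun a => ({φ a} : Set M)) w = {wordValue φ w} := by
  induction w with
  | nil => rfl
  | cons a w ih => rw [wordValue_cons, wordValue_cons, ih, Set.singleton_mul_singleton]

theorem map_wordValue {A M N : Type*} [Monoid M] [Monoid N] (h : M →* N) (φ : A → M)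
    (w : List A) : h (wordValue φ w) = wordValue (fun a => h (φ a)) w := by
  simp [wordValue, map_list_prod, Function.comp_def]

-- The star-free partition is taken in the monoid of pairs (group value, reachable set). The bound
-- of a piece is a reachable set containing the `φ`-values of all its words. If the piece contains a
-- word of `L`, this set must avoid some `Q i`, so the piece avoids `L' i`.
universe u in
theorem coverable_of_isSaturatedFamily {A M : Type u} {ι : Type*} [Finite A] [Monoid M] [Finite M]
    {C : Set (Language A)} (hC : IsQuotientClosedBooleanAlgebra C)
    (hgroup : ∀ L ∈ C, IsGroupLanguage L) (φ : A → M) {N : ℕ} {L : Language A}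
    {L' : ι → Language A} {P : Set M} {Q : ι → Set M} (hP : ∀ w, w ∈ L ↔ wordValue φ w ∈ P)
    (hQ : ∀ i w, w ∈ L' i ↔ wordValue φ w ∈ Q i) {F : Set (Set M)}
    (hF : IsSaturatedFamily C φ N F) (hmeets : ∀ w, ∀ T ∈ reach F φ w, ¬ Meets P Q T) :
    Coverable (StarFreeClosure C) L (Set.range L') := by
  -- a single separator for all sets that can be separated
  let Sep : Set M → Prop := fun T => Separable C {[]} ({w | T ∈ reach F φ w} : Language A)
  have hsep : ∀ T : Set M, ∃ K ∈ C, [] ∈ K ∧ (Sep T → ∀ w ∈ K, T ∉ reach F φ w) := by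
    intro T
    by_cases hT : Sep T
    · obtain ⟨K, hK, h1, h2⟩ := hT
      refine ⟨K, hK, h1 rfl, fun _ w hw hwT => ?_⟩
      have : w ∈ (⊥ : Language A) := h2 ▸ (⟨hwT, hw⟩ : w ∈ {w | T ∈ reach F φ w} ⊓ K)
      exact this
    · exact ⟨⊤, hC.top_mem, trivial, fun h => absurd h hT⟩
  choose K hKC hKnil hKsep using hsep
  obtain ⟨G, _, _, f, hf, hfK⟩ := exists_classMorphism hC hgroup
    (hC.forall_mem (Set.finite_range K) (by rintro _ ⟨T, rfl⟩; exact hKC T))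
  -- A word of group value `1` lies in all the chosen separators because the empty word does. So a
  -- set reached along it cannot be separable, and saturation applies.
  have hone : ∀ w T, wordValue f w = 1 → T ∈ reach F φ w →
      ∃ U ∈ F, T ^ N ⊆ U ∧ T ^ (N + 1) ⊆ U := by
    intro w T hw hT
    refine hF.pow_mem T fun hs => ?_
    have h1 : ([] : List A) ∈ ({w | ∀ L ∈ Set.range K, w ∈ L} : Language A) := by
      rintro _ ⟨T, rfl⟩
      exact hKnil T
    have h2 := (hfK [] w (by rw [hw, wordValue_nil])).1 h1
    exact hKsep T hs w (h2 _ ⟨T, rfl⟩) hT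
  let S : Submonoid (G × Set M) :=
    { carrier := {p | ∃ w, p.1 = wordValue f w ∧ p.2 ∈ reach F φ w}
      one_mem' := ⟨[], rfl, {1}, hF.one_mem, {1}, rfl, one_mul (1 : Set M)⟩
      mul_mem' := by
        rintro ⟨g, T⟩ ⟨g', T'⟩ ⟨w, rfl, hT⟩ ⟨w', rfl, hT'⟩
        refine ⟨w ++ w', (wordValue_append _ _ _).symm, ?_⟩
        rw [← hF.reach_mul]
        exact Set.mul_mem_mul hT hT' }
  let π : S →* G := (MonoidHom.fst G (Set M)).comp S.subtype
  let σ : S →* Set M := (MonoidHom.snd G (Set M)).comp S.subtype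
  let le : S → S → Prop := fun s t => π s = π t ∧ σ s ⊆ σ t
  have hle : IsSaturatedOrder π le :=
    { refl := fun s => ⟨rfl, subset_rfl⟩
      trans := fun s t u h h' => ⟨h.1.trans h'.1, h.2.trans h'.2⟩
      mul := fun s s' t t' h h' => ⟨by rw [map_mul, map_mul, h.1, h'.1], by
        rw [map_mul, map_mul]; exact Set.mul_subset_mul h.2 h'.2⟩
      map_eq := fun s t h => h.1
      pow := fun s hs => by
        obtain ⟨w, hw, hT⟩ := s.2
        obtain ⟨U, hU, h1, h2⟩ := hone w _ (hw.symm.trans hs) hT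
        refine ⟨N, ⟨(1, U), [], rfl, by simpa [reach, wordValue_nil] using hU⟩, ⟨?_, ?_⟩, ?_, ?_⟩
        · rw [map_pow, hs, one_pow]; rfl
        · rw [map_pow]; exact h1
        · rw [map_pow, hs, one_pow]; rfl
        · rw [map_pow]; exact h2 }
  let g : A → S := fun a => ⟨(f a, {φ a}), [a], by simp [wordValue], by
    refine ⟨{1}, hF.one_mem, {φ a}, ?_, by simp⟩
    rw [wordValue_cons, wordValue_nil, mul_one]
    exact ⟨{φ a}, rfl, {1}, hF.one_mem, by simp⟩⟩
  have hg1 : ∀ w, π (wordValue g w) = wordValue f w := fun w => map_wordValue π g w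
  have hg2 : ∀ w, σ (wordValue g w) = {wordValue φ w} := fun w => by
    rw [map_wordValue σ g w, ← wordValue_singleton]
    rfl
  obtain ⟨κ, hκ, hκb⟩ := hle.hasBoundedPartition _ rfl g Set.univ
  let H : S → Language A := fun t => {w | κ w = t}
  have hHmem : ∀ t, H t ∈ StarFreeClosure C := by
    intro t
    refine InStarFreeClosure.mono ?_ ((hκ t).of_eq fun w =>
      ⟨fun h => h.2, fun h => ⟨fun _ _ => trivial, h⟩⟩)
    rintro _ ⟨x, rfl⟩
    simp only [hg1]
    exact .base _ (hf x)
  refine ⟨H '' {t | ∃ w ∈ L, κ w = t}, ⟨Set.toFinite _, ?_, ?_⟩, ?_⟩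
  · rintro _ ⟨t, -, rfl⟩
    exact hHmem t
  · exact fun w hw => ⟨H (κ w), ⟨κ w, ⟨w, hw, rfl⟩, rfl⟩, rfl⟩
  · rintro _ ⟨_, ⟨w, hw, rfl⟩, rfl⟩
    have hmem : ∀ x, κ x = κ w → wordValue φ x ∈ σ (κ w) := fun x hx =>
      hx ▸ (hκb x fun _ _ => trivial).2 (by rw [hg2]; rfl)
    obtain ⟨v, -, hv⟩ := (κ w).2
    have := hmeets v _ hv
    simp only [Meets, not_and, not_forall] at this
    obtain ⟨i, hi⟩ := this ⟨_, hmem w rfl, (hP w).1 hw⟩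
    refine ⟨_, ⟨i, rfl⟩, eq_bot_iff.2 fun x hx => hi ⟨_, hmem x hx.1, (hQ i x).1 hx.2⟩⟩

/-! ### Computability of bounded quantifiers -/

section Computability

variable {α β γ : Type*} [Primcodable α] [Primcodable β] [Primcodable γ]

theorem primrecPred_exists_mem {f : α → List β} {R : α → β → Prop} (hf : Primrec f)
    (hR : PrimrecRel R) : PrimrecPred fun a => ∃ b ∈ f a, R a b :=
  hR.swap.exists_mem_list.comp hf Primrec.id

theorem primrecPred_forall_mem {f : α → List β} {R : α → β → Prop} (hf : Primrec f)
    (hR : PrimrecRel R) : PrimrecPred fun a => ∀ b ∈ f a, R a b :=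
  hR.swap.forall_mem_list.comp hf Primrec.id

theorem primrecPred_eq {f g : α → β} (hf : Primrec f) (hg : Primrec g) :
    PrimrecPred fun a => f a = g a :=
  Primrec.eq.comp hf hg

theorem primrecPred_mem {f : α → β} {g : α → List β} (hf : Primrec f) (hg : Primrec g) :
    PrimrecPred fun a => f a ∈ g a :=
  (primrecPred_exists_mem (R := fun a b => b = f a) hg
    (primrecPred_eq Primrec.snd (hf.comp Primrec.fst))).of_eq fun a => by simp

open Classical in
theorem primrec_filter {f : α → List β} {R : α → β → Prop} (hf : Primrec f)
    (hR : PrimrecRel R) : Primrec fun a => (f a).filter fun b => R a b := by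
  refine (Primrec.listFilterMap hf (g := fun a b => if R a b then some b else none)
    (Primrec.ite hR (Primrec.option_some.comp Primrec.snd) (Primrec.const none))).of_eq fun a => ?_
  induction f a with
  | nil => rfl
  | cons b l ih => by_cases h : R a b <;> simp [h, ih]

theorem computablePred_comp {p : β → Prop} {f : α → β} (hp : ComputablePred p)
    (hf : Computable f) : ComputablePred fun a => p (f a) := by
  obtain ⟨g, hg, rfl⟩ := ComputablePred.computable_iff.1 hp
  exact ComputablePred.computable_iff.2 ⟨_, hg.comp hf, rfl⟩

theorem computablePred_and {p q : α → Prop} (hp : ComputablePred p) (hq : ComputablePred q) :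
    ComputablePred fun a => p a ∧ q a := by
  obtain ⟨f, hf, rfl⟩ := ComputablePred.computable_iff.1 hp
  obtain ⟨g, hg, rfl⟩ := ComputablePred.computable_iff.1 hq
  exact ComputablePred.computable_iff.2 ⟨fun a => f a && g a,
    Primrec.and.to_comp.comp hf hg, by simp⟩

theorem computablePred_or {p q : α → Prop} (hp : ComputablePred p) (hq : ComputablePred q) :
    ComputablePred fun a => p a ∨ q a := by
  obtain ⟨f, hf, rfl⟩ := ComputablePred.computable_iff.1 hp
  obtain ⟨g, hg, rfl⟩ := ComputablePred.computable_iff.1 hq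
  exact ComputablePred.computable_iff.2 ⟨fun a => f a || g a,
    Primrec.or.to_comp.comp hf hg, by simp⟩

theorem computablePred_exists_mem {l : α → List β} {p : α × β → Prop} (hl : Computable l)
    (hp : ComputablePred p) : ComputablePred fun a => ∃ b ∈ l a, p (a, b) := by
  obtain ⟨g, hg, rfl⟩ := ComputablePred.computable_iff.1 hp
  -- Whether one of the first `n` entries of the list satisfies the predicate, by primitive
  -- recursion on `n`.
  let h : α → ℕ → Bool := fun a n =>
    Nat.rec false (fun i acc => acc || Option.casesOn (l a)[i]? false fun b => g (a, b)) n
  have hh : Computable fun a => h a (l a).length := by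
    refine Computable.nat_rec (Computable.list_length.comp hl) (Computable.const false)
      (h := fun a x => x.2 || Option.casesOn (l a)[x.1]? false fun b => g (a, b)) ?_
    refine Primrec.or.to_comp.comp (Computable.snd.comp Computable.snd) ?_
    exact Computable.option_casesOn (Computable.list_getElem?.comp (hl.comp Computable.fst)
      (Computable.fst.comp Computable.snd)) (Computable.const false)
      (hg.comp (Computable.pair (Computable.fst.comp Computable.fst) Computable.snd))
  have hspec : ∀ a n, h a n = true ↔ ∃ i < n, ∃ b, (l a)[i]? = some b ∧ g (a, b) = true := by
    intro a n
    induction n with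
    | zero => simp [h]
    | succ n ih =>
      have : h a (n + 1) = (h a n || Option.casesOn (l a)[n]? false fun b => g (a, b)) := rfl
      rw [this, Bool.or_eq_true, ih]
      constructor
      · rintro (⟨i, hi, hb⟩ | hb)
        · exact ⟨i, by omega, hb⟩
        · refine ⟨n, by omega, ?_⟩
          cases hn : (l a)[n]? with
          | none => simp [hn] at hb
          | some b => exact ⟨b, rfl, by simpa [hn] using hb⟩
      · rintro ⟨i, hi, b, hb⟩
        rcases Nat.lt_succ_iff_lt_or_eq.1 hi with hi | rfl
        · exact Or.inl ⟨i, hi, b, hb⟩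
        · right
          rw [hb.1]
          exact hb.2
  refine ComputablePred.computable_iff.2 ⟨_, hh, funext fun a => propext ?_⟩
  rw [hspec]
  constructor
  · rintro ⟨b, hb, hgb⟩
    obtain ⟨i, hi⟩ := List.mem_iff_getElem?.1 hb
    exact ⟨i, (List.getElem?_eq_some_iff.1 hi).1, b, hi, hgb⟩
  · rintro ⟨i, -, b, hb, hgb⟩
    exact ⟨b, List.mem_of_getElem? hb, hgb⟩

theorem computablePred_forall_mem {l : α → List β} {p : α × β → Prop} (hl : Computable l)
    (hp : ComputablePred p) : ComputablePred fun a => ∀ b ∈ l a, p (a, b) :=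
  (computablePred_exists_mem hl hp.not).not.of_eq fun a => by simp

end Computability

/-! ### Lists as codes of sets -/

/-- All sublists of a list. -/
def subl {α : Type*} (l : List α) : List (List α) :=
  l.foldr (fun a r => r ++ r.map (List.cons a)) [[]]

theorem subl_cons {α : Type*} (a : α) (l : List α) :
    subl (a :: l) = subl l ++ (subl l).map (List.cons a) := rfl

theorem mem_of_mem_subl {α : Type*} {l s : List α} (hs : s ∈ subl l) : ∀ a ∈ s, a ∈ l := by
  induction l generalizing s with
  | nil =>
    obtain rfl : s = [] := List.mem_singleton.1 hs
    simp
  | cons b l ih =>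
    rw [subl_cons, List.mem_append, List.mem_map] at hs
    rcases hs with hs | ⟨t, ht, rfl⟩
    · exact fun a ha => List.mem_cons_of_mem _ (ih hs a ha)
    · intro a ha
      rcases List.mem_cons.1 ha with rfl | ha
      · exact List.mem_cons_self
      · exact List.mem_cons_of_mem _ (ih ht a ha)

theorem filter_mem_subl {α : Type*} (l : List α) (p : α → Bool) : l.filter p ∈ subl l := by
  induction l with
  | nil => exact List.mem_singleton.2 rfl
  | cons a l ih =>
    rw [subl_cons, List.mem_append, List.mem_map]
    by_cases h : p a
    · exact Or.inr ⟨_, ih, by simp [h]⟩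
    · exact Or.inl (by simpa [h] using ih)

theorem primrec_subl {α : Type*} [Primcodable α] : Primrec (subl : List α → List (List α)) := by
  refine Primrec.list_foldr (h := fun (_ : List α) (x : α × List (List α)) =>
    x.2 ++ x.2.map (List.cons x.1)) Primrec.id
    (Primrec.const [[]]) ?_
  have h2 : Primrec fun x : List α × (α × List (List α)) => x.2.2 :=
    Primrec.snd.comp Primrec.snd
  refine Primrec.list_append.comp h2 (Primrec.list_map h2 ?_)
  exact Primrec.list_cons.comp (Primrec.fst.comp (Primrec.snd.comp Primrec.fst)) Primrec.snd

/-- All pairs of elements of a list. -/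
def pairs {σ : Type*} (Q : List σ) : List (σ × σ) := Q.flatMap fun p => Q.map fun q => (p, q)

theorem mem_pairs {σ : Type*} {Q : List σ} {x : σ × σ} : x ∈ pairs Q ↔ x.1 ∈ Q ∧ x.2 ∈ Q := by
  obtain ⟨p, q⟩ := x
  simp [pairs]

theorem primrec_pairs {σ : Type*} [Primcodable σ] : Primrec (pairs : List σ → List (σ × σ)) :=
  Primrec.list_flatMap Primrec.id (Primrec.list_map Primrec.fst
    (Primrec.pair (Primrec.snd.comp Primrec.fst) Primrec.snd))

/-- The finite data of an automaton without initial and final states: the list of its states and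
the list of its transitions. -/
abbrev TransitionData (σ A : Type*) : Type _ := List σ × List (σ × A × σ)

namespace TransitionData

variable {σ A : Type*}

/-- The codes of the relations between states. -/
def rels (d : TransitionData σ A) : List (List (σ × σ)) := subl (pairs d.1)

/-- The codes of the sets of relations between states. -/
def relSets (d : TransitionData σ A) : List (List (List (σ × σ))) := subl d.rels

open Classical in
/-- The code of the relation `r`. -/
noncomputable def ofRel (d : TransitionData σ A) (r : σ × σ → Prop) : List (σ × σ) :=
  (pairs d.1).filter fun x => r x

open Classical in
/-- The code of the set `s` of relations. -/
noncomputable def ofSet (d : TransitionData σ A) (s : List (σ × σ) → Prop) :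
    List (List (σ × σ)) :=
  d.rels.filter fun x => s x

theorem ofRel_mem (d : TransitionData σ A) (r : σ × σ → Prop) : d.ofRel r ∈ d.rels :=
  filter_mem_subl _ _

theorem ofSet_mem (d : TransitionData σ A) (s : List (σ × σ) → Prop) : d.ofSet s ∈ d.relSets :=
  filter_mem_subl _ _

theorem mem_ofRel {d : TransitionData σ A} {r : σ × σ → Prop} {x : σ × σ} :
    x ∈ d.ofRel r ↔ (x.1 ∈ d.1 ∧ x.2 ∈ d.1) ∧ r x := by
  simp [ofRel, mem_pairs]

theorem mem_ofSet {d : TransitionData σ A} {s : List (σ × σ) → Prop} {x : List (σ × σ)} :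
    x ∈ d.ofSet s ↔ x ∈ d.rels ∧ s x := by
  simp [ofSet]

/-- The composition of two relations. -/
noncomputable def comp (d : TransitionData σ A) (s t : List (σ × σ)) : List (σ × σ) :=
  d.ofRel fun x => ∃ r ∈ d.1, (x.1, r) ∈ s ∧ (r, x.2) ∈ t

/-- The product of two sets of relations. -/
noncomputable def mulSet (d : TransitionData σ A) (S T : List (List (σ × σ))) :
    List (List (σ × σ)) :=
  d.ofSet fun x => ∃ s ∈ S, ∃ t ∈ T, x = d.comp s t

/-- The singleton of the identity relation. -/
noncomputable def oneSet (d : TransitionData σ A) : List (List (σ × σ)) :=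
  d.ofSet fun x => x = d.ofRel fun x => x.1 = x.2

/-- The singleton of the relation which a letter induces. -/
noncomputable def letterSet (d : TransitionData σ A) (a : A) : List (List (σ × σ)) :=
  d.ofSet fun x => x = d.ofRel fun x => (x.1, a, x.2) ∈ d.2

/-- The powers of a set of relations. -/
noncomputable def powSet (d : TransitionData σ A) (T : List (List (σ × σ))) (n : ℕ) :
    List (List (σ × σ)) :=
  Nat.rec d.oneSet (fun _ S => d.mulSet S T) n

/-- The product of `V`, the singleton of the relation of `a`, and `U`. -/
noncomputable def step (d : TransitionData σ A) (V : List (List (σ × σ))) (a : A)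
    (U : List (List (σ × σ))) : List (List (σ × σ)) :=
  d.mulSet (d.mulSet V (d.letterSet a)) U

/-- The automaton whose states are the codes of sets of relations, and which accepts the words
along which the members of `F` lead to a member of `acc`. -/
noncomputable def automaton [Encodable σ] [Finite A] (d : TransitionData σ A)
    (F acc : List (List (List (σ × σ)))) : Automaton A :=
  (F.map Encodable.encode,
    d.relSets.flatMap (fun V => (Set.toFinite (Set.univ : Set A)).toFinset.toList.flatMap fun a =>
      F.map fun U => (Encodable.encode V, a, Encodable.encode (d.step V a U))),
    acc.map Encodable.encode)

/-! ### Primitive recursiveness of the operations on codes -/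

section Primrec

variable [Primcodable σ] [Primcodable A] {α : Type*} [Primcodable α]

theorem primrec_rels : Primrec (rels : TransitionData σ A → _) :=
  primrec_subl.comp (primrec_pairs.comp Primrec.fst)

theorem primrec_relSets : Primrec (relSets : TransitionData σ A → _) :=
  primrec_subl.comp primrec_rels

theorem primrec_ofRel {d : α → TransitionData σ A} (hd : Primrec d) {r : α → σ × σ → Prop}
    (hr : PrimrecRel r) : Primrec fun a => (d a).ofRel (r a) :=
  primrec_filter (primrec_pairs.comp (Primrec.fst.comp hd)) hr

theorem primrec_ofSet {d : α → TransitionData σ A} (hd : Primrec d)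
    {s : α → List (σ × σ) → Prop} (hs : PrimrecRel s) : Primrec fun a => (d a).ofSet (s a) :=
  primrec_filter (primrec_rels.comp hd) hs

theorem primrec_comp {d : α → TransitionData σ A} (hd : Primrec d) {s t : α → List (σ × σ)}
    (hs : Primrec s) (ht : Primrec t) : Primrec fun a => (d a).comp (s a) (t a) := by
  refine primrec_ofRel hd (primrecPred_exists_mem
    (Primrec.fst.comp (hd.comp Primrec.fst)) (PrimrecPred.and ?_ ?_))
  · exact primrecPred_mem (Primrec.pair (Primrec.fst.comp (Primrec.snd.comp Primrec.fst))
      Primrec.snd) (hs.comp (Primrec.fst.comp Primrec.fst))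
  · exact primrecPred_mem (Primrec.pair Primrec.snd
      (Primrec.snd.comp (Primrec.snd.comp Primrec.fst))) (ht.comp (Primrec.fst.comp Primrec.fst))

theorem primrec_mulSet {d : α → TransitionData σ A} (hd : Primrec d)
    {S T : α → List (List (σ × σ))} (hS : Primrec S) (hT : Primrec T) :
    Primrec fun a => (d a).mulSet (S a) (T a) := by
  refine primrec_ofSet hd (primrecPred_exists_mem (hS.comp Primrec.fst)
    (primrecPred_exists_mem (hT.comp (Primrec.fst.comp Primrec.fst)) (primrecPred_eq ?_ ?_)))
  · exact Primrec.snd.comp (Primrec.fst.comp Primrec.fst)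
  · exact primrec_comp (hd.comp (Primrec.fst.comp (Primrec.fst.comp Primrec.fst)))
      (Primrec.snd.comp Primrec.fst) Primrec.snd

theorem primrec_oneSet : Primrec (oneSet : TransitionData σ A → _) := by
  refine primrec_ofSet Primrec.id (primrecPred_eq Primrec.snd (primrec_ofRel Primrec.fst ?_))
  exact primrecPred_eq (Primrec.fst.comp Primrec.snd) (Primrec.snd.comp Primrec.snd)

theorem primrec_letterSet {d : α → TransitionData σ A} (hd : Primrec d) {l : α → A}
    (hl : Primrec l) : Primrec fun a => (d a).letterSet (l a) := by
  refine primrec_ofSet hd (primrecPred_eq Primrec.snd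
    (primrec_ofRel (hd.comp Primrec.fst) (primrecPred_mem ?_ ?_)))
  · exact Primrec.pair (Primrec.fst.comp Primrec.snd) (Primrec.pair
      (hl.comp (Primrec.fst.comp Primrec.fst)) (Primrec.snd.comp Primrec.snd))
  · exact Primrec.snd.comp (hd.comp (Primrec.fst.comp Primrec.fst))

theorem primrec_powSet {d : α → TransitionData σ A} (hd : Primrec d)
    {T : α → List (List (σ × σ))} (hT : Primrec T) {n : α → ℕ} (hn : Primrec n) :
    Primrec fun a => (d a).powSet (T a) (n a) :=
  Primrec.nat_rec' (h := fun a x => (d a).mulSet x.2 (T a)) hn (primrec_oneSet.comp hd)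
    (primrec_mulSet (hd.comp Primrec.fst) (Primrec.snd.comp Primrec.snd) (hT.comp Primrec.fst))

theorem primrec_automaton [Finite A] {d : α → TransitionData σ A} (hd : Primrec d)
    {F acc : α → List (List (List (σ × σ)))} (hF : Primrec F) (hacc : Primrec acc) :
    Primrec fun a => (d a).automaton (F a) (acc a) := by
  have henc : ∀ {f : α → List (List (List (σ × σ)))}, Primrec f →
      Primrec fun a => (f a).map Encodable.encode := fun hf =>
    Primrec.list_map hf (Primrec.encode.comp Primrec.snd)
  refine Primrec.pair (henc hF) (Primrec.pair ?_ (henc hacc))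
  -- The alphabet is fixed, so its list of letters is a constant, however it was chosen.
  refine Primrec.list_flatMap (primrec_relSets.comp hd) (Primrec.list_flatMap (Primrec.const _)
    (Primrec.list_map (hF.comp (Primrec.fst.comp Primrec.fst)) ?_))
  have hV := Primrec.snd.comp (Primrec.fst.comp (Primrec.fst (α := (α × List (List (σ × σ))) × A)
    (β := List (List (σ × σ)))))
  have ha := Primrec.snd.comp (Primrec.fst (α := (α × List (List (σ × σ))) × A)
    (β := List (List (σ × σ))))
  have hd' := hd.comp (Primrec.fst.comp (Primrec.fst.comp
    (Primrec.fst (α := (α × List (List (σ × σ))) × A) (β := List (List (σ × σ))))))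
  exact Primrec.pair (Primrec.encode.comp hV) (Primrec.pair ha (Primrec.encode.comp
    (primrec_mulSet hd' (primrec_mulSet hd' hV (primrec_letterSet hd' ha)) Primrec.snd)))

end Primrec

end TransitionData

/-! ### Meaning of the codes -/

/-- The binary relations on a type. -/
def RelMonoid (τ : Type*) : Type _ := τ → τ → Prop

instance (τ : Type*) : Monoid (RelMonoid τ) where
  mul r s := fun p q => ∃ x, r p x ∧ s x q
  one := fun p q => p = q
  mul_assoc r s t := by
    funext p q
    refine propext ⟨?_, ?_⟩
    · rintro ⟨x, ⟨y, h1, h2⟩, h3⟩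
      exact ⟨y, h1, x, h2, h3⟩
    · rintro ⟨y, h1, x, h2, h3⟩
      exact ⟨x, ⟨y, h1, h2⟩, h3⟩
  one_mul r := by
    funext p q
    refine propext ⟨?_, fun h => ⟨p, rfl, h⟩⟩
    rintro ⟨_, rfl, h⟩
    exact h
  mul_one r := by
    funext p q
    refine propext ⟨?_, fun h => ⟨q, h, rfl⟩⟩
    rintro ⟨_, h, rfl⟩
    exact h

instance (τ : Type*) [Finite τ] : Finite (RelMonoid τ) := inferInstanceAs (Finite (τ → τ → Prop))

theorem RelMonoid.mul_apply {τ : Type*} (r s : RelMonoid τ) (p q : τ) :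
    (r * s) p q ↔ ∃ x, r p x ∧ s x q := Iff.rfl

theorem RelMonoid.one_apply {τ : Type*} (p q : τ) : (1 : RelMonoid τ) p q ↔ p = q := Iff.rfl

/-- By pigeonhole the powers of `x` are periodic from some exponent at most `N` on, so adding a
multiple of the period to `N` does not change the power. -/
theorem exists_pow_eq_of_card_le {M : Type*} [Monoid M] [Finite M] {N : ℕ}
    (hN : Nat.card M ≤ N) (x : M) (k : ℕ) : ∃ n ≥ k, x ^ n = x ^ N := by
  have hcard : Nat.card M < Nat.card (Fin (N + 1)) := by simpa using Nat.lt_succ_of_le hN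
  have := Fintype.ofFinite M
  obtain ⟨i, j, hij, h⟩ := Fintype.exists_ne_map_eq_of_card_lt (fun i : Fin (N + 1) => x ^ (i : ℕ))
    (by simpa [Nat.card_eq_fintype_card] using hcard)
  wlog hlt : i < j generalizing i j
  · exact this j i hij.symm h.symm (lt_of_le_of_ne (not_lt.1 hlt) hij.symm)
  have hlt' : (i : ℕ) < j := hlt
  have hj : (j : ℕ) ≤ N := Nat.lt_succ_iff.1 j.2
  have hp : x ^ (N + (j - i : ℕ)) = x ^ N := by
    have h1 : N + (j - i : ℕ) = j + (N - i) := by omega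
    have h2 : N = i + (N - i) := by omega
    rw [h1, pow_add, ← h, ← pow_add, ← h2]
  have key : ∀ m, x ^ (N + m * (j - i : ℕ)) = x ^ N := by
    intro m
    induction m with
    | zero => simp
    | succ m ih => rw [add_mul, one_mul, ← add_assoc, pow_add, ih, ← pow_add, hp]
  refine ⟨N + k * (j - i : ℕ), ?_, key k⟩
  have : k * 1 ≤ k * (j - i : ℕ) := Nat.mul_le_mul_left k (by omega)
  omega

namespace TransitionData

variable {σ A : Type*} (d : TransitionData σ A)

/-- The relation with a given code. -/
def den (s : List (σ × σ)) : RelMonoid {p // p ∈ d.1} := fun p q => (p.1, q.1) ∈ s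

/-- The set of relations with a given code. -/
def denSet (T : List (List (σ × σ))) : Set (RelMonoid {p // p ∈ d.1}) := {m | ∃ s ∈ T, d.den s = m}

/-- The family of sets of relations with a given code. -/
def denFamily (F : List (List (List (σ × σ)))) : Set (Set (RelMonoid {p // p ∈ d.1})) :=
  {S | ∃ T ∈ F, d.denSet T = S}

/-- The relation which a letter induces. -/
def letterRel (a : A) : RelMonoid {p // p ∈ d.1} := fun p q => (p.1, a, q.1) ∈ d.2

theorem den_ofRel (r : σ × σ → Prop) : d.den (d.ofRel r) = fun p q => r (p.1, q.1) := by
  funext p q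
  exact propext (mem_ofRel.trans ⟨fun h => h.2, fun h => ⟨⟨p.2, q.2⟩, h⟩⟩)

theorem exists_den (m : RelMonoid {p // p ∈ d.1}) : ∃ s ∈ d.rels, d.den s = m := by
  refine ⟨d.ofRel fun x => ∃ (h1 : x.1 ∈ d.1) (h2 : x.2 ∈ d.1), m ⟨x.1, h1⟩ ⟨x.2, h2⟩,
    d.ofRel_mem _, ?_⟩
  rw [den_ofRel]
  funext p q
  exact propext ⟨fun ⟨_, _, h⟩ => h, fun h => ⟨p.2, q.2, h⟩⟩

theorem den_comp (s t : List (σ × σ)) : d.den (d.comp s t) = d.den s * d.den t := by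
  rw [comp, den_ofRel]
  funext p q
  refine propext ⟨?_, ?_⟩
  · rintro ⟨r, hr, h⟩
    exact ⟨⟨r, hr⟩, h⟩
  · rintro ⟨r, h⟩
    exact ⟨r.1, r.2, h⟩

theorem comp_mem (s t : List (σ × σ)) : d.comp s t ∈ d.rels := d.ofRel_mem _

theorem denSet_mulSet (S T : List (List (σ × σ))) :
    d.denSet (d.mulSet S T) = d.denSet S * d.denSet T := by
  ext m
  constructor
  · rintro ⟨_, hx, rfl⟩
    obtain ⟨s, hs, t, ht, rfl⟩ := (mem_ofSet.1 hx).2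
    exact ⟨d.den s, ⟨s, hs, rfl⟩, d.den t, ⟨t, ht, rfl⟩, (d.den_comp s t).symm⟩
  · rintro ⟨_, ⟨s, hs, rfl⟩, _, ⟨t, ht, rfl⟩, rfl⟩
    exact ⟨d.comp s t, mem_ofSet.2 ⟨d.comp_mem s t, s, hs, t, ht, rfl⟩, d.den_comp s t⟩

theorem denSet_oneSet : d.denSet d.oneSet = {1} := by
  have h : d.den (d.ofRel fun x => x.1 = x.2) = 1 := by
    rw [den_ofRel]
    funext p q
    exact propext Subtype.ext_iff.symm
  ext m
  constructor
  · rintro ⟨_, hx, rfl⟩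
    rw [(mem_ofSet.1 hx).2, h]
    rfl
  · rintro rfl
    exact ⟨_, mem_ofSet.2 ⟨d.ofRel_mem _, rfl⟩, h⟩

theorem denSet_letterSet (a : A) : d.denSet (d.letterSet a) = {d.letterRel a} := by
  have h : d.den (d.ofRel fun x => (x.1, a, x.2) ∈ d.2) = d.letterRel a := d.den_ofRel _
  ext m
  constructor
  · rintro ⟨_, hx, rfl⟩
    rw [(mem_ofSet.1 hx).2, h]
    rfl
  · rintro rfl
    exact ⟨_, mem_ofSet.2 ⟨d.ofRel_mem _, rfl⟩, h⟩

theorem denSet_step (V : List (List (σ × σ))) (a : A) (U : List (List (σ × σ))) :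
    d.denSet (d.step V a U) = d.denSet V * {d.letterRel a} * d.denSet U := by
  rw [step, denSet_mulSet, denSet_mulSet, denSet_letterSet]

theorem denSet_powSet (T : List (List (σ × σ))) (n : ℕ) :
    d.denSet (d.powSet T n) = d.denSet T ^ n := by
  induction n with
  | zero => rw [pow_zero]; exact d.denSet_oneSet
  | succ n ih => rw [pow_succ, ← ih, ← denSet_mulSet]; rfl

theorem powSet_mem (T : List (List (σ × σ))) (n : ℕ) : d.powSet T n ∈ d.relSets := by
  cases n <;> exact d.ofSet_mem _

theorem denSet_mono {S T : List (List (σ × σ))} (h : ∀ s ∈ S, s ∈ T) :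
    d.denSet S ⊆ d.denSet T := by
  rintro _ ⟨s, hs, rfl⟩
  exact ⟨s, h s hs, rfl⟩

theorem denSet_ofSet (S : Set (RelMonoid {p // p ∈ d.1})) :
    d.denSet (d.ofSet fun s => d.den s ∈ S) = S := by
  ext m
  constructor
  · rintro ⟨s, hs, rfl⟩
    exact (mem_ofSet.1 hs).2
  · intro hm
    obtain ⟨s, hs, rfl⟩ := d.exists_den m
    exact ⟨s, mem_ofSet.2 ⟨hs, hm⟩, rfl⟩

/-- Thus the number of codes, which is computable, can serve as the exponent `N` of saturated
families. -/
theorem card_le : Nat.card (Set (RelMonoid {p // p ∈ d.1})) ≤ d.relSets.length := by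
  have h : Function.Surjective fun i : Fin d.relSets.length => d.denSet (d.relSets.get i) := by
    intro S
    obtain ⟨i, hi⟩ := List.get_of_mem (d.ofSet_mem fun s => d.den s ∈ S)
    exact ⟨i, by simp only [hi, denSet_ofSet]⟩
  simpa using Nat.card_le_card_of_surjective _ h

/-- The codes of the sets to which the members of `F` lead along a word. -/
noncomputable def runs (F : List (List (List (σ × σ)))) (w : List A) :
    List (List (List (σ × σ))) :=
  w.foldl (fun R a => R.flatMap fun V => F.map (d.step V a)) F

theorem mem_runs_append_singleton {F : List (List (List (σ × σ)))} {w : List A} {a : A}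
    {W : List (List (σ × σ))} :
    W ∈ d.runs F (w ++ [a]) ↔ ∃ V ∈ d.runs F w, ∃ U ∈ F, d.step V a U = W := by
  simp [runs]

theorem runs_subset {F : List (List (List (σ × σ)))} (hF : ∀ T ∈ F, T ∈ d.relSets) (w : List A) :
    ∀ V ∈ d.runs F w, V ∈ d.relSets := by
  induction w using List.reverseRecOn with
  | nil => exact hF
  | append_singleton w a _ =>
    intro W hW
    obtain ⟨V, -, U, -, rfl⟩ := d.mem_runs_append_singleton.1 hW
    exact d.ofSet_mem _

theorem mem_reach_iff (F : List (List (List (σ × σ)))) (w : List A)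
    (S : Set (RelMonoid {p // p ∈ d.1})) :
    S ∈ reach (d.denFamily F) d.letterRel w ↔ ∃ V ∈ d.runs F w, d.denSet V = S := by
  induction w using List.reverseRecOn generalizing S with
  | nil =>
    simp only [reach, wordValue_nil, mul_one]
    rfl
  | append_singleton w a ih =>
    have : reach (d.denFamily F) d.letterRel (w ++ [a]) =
        reach (d.denFamily F) d.letterRel w * ({{d.letterRel a}} * d.denFamily F) := by
      simp only [reach, wordValue_append, wordValue_cons, wordValue_nil, mul_one, mul_assoc]
    rw [this]
    constructor
    · rintro ⟨S₁, hS₁, _, ⟨_, rfl, _, ⟨U, hU, rfl⟩, rfl⟩, rfl⟩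
      obtain ⟨V, hV, rfl⟩ := (ih S₁).1 hS₁
      refine ⟨_, d.mem_runs_append_singleton.2 ⟨V, hV, U, hU, rfl⟩, ?_⟩
      rw [denSet_step, mul_assoc]
    · rintro ⟨W, hW, rfl⟩
      obtain ⟨V, hV, U, hU, rfl⟩ := d.mem_runs_append_singleton.1 hW
      rw [denSet_step, mul_assoc]
      exact Set.mul_mem_mul ((ih _).2 ⟨V, hV, rfl⟩) (Set.mul_mem_mul rfl ⟨U, hU, rfl⟩)

/-- With `mem_reach_iff`, this makes reachability of a set a regular property of the word, so that
it can be passed to the separation algorithm. -/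
theorem mem_language_automaton [Encodable σ] [Finite A] {F acc : List (List (List (σ × σ)))}
    (hF : ∀ T ∈ F, T ∈ d.relSets) (w : List A) :
    w ∈ Automaton.language (d.automaton F acc) ↔ ∃ V ∈ acc, V ∈ d.runs F w := by
  have key : ∀ n, n ∈ (d.automaton F acc).toNFA.evalFrom (d.automaton F acc).toNFA.start w ↔
      ∃ V ∈ d.runs F w, Encodable.encode V = n := by
    induction w using List.reverseRecOn with
    | nil =>
      intro n
      rw [NFA.evalFrom_nil]
      change n ∈ F.map Encodable.encode ↔ _
      rw [List.mem_map]
      rfl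
    | append_singleton w a ih =>
      intro n
      rw [NFA.evalFrom_append, NFA.evalFrom_singleton, NFA.mem_stepSet]
      constructor
      · rintro ⟨m, hm, hn⟩
        obtain ⟨V, hV, rfl⟩ := (ih m).1 hm
        change (_, a, n) ∈ (d.automaton F acc).2.1 at hn
        simp only [automaton, List.mem_flatMap, List.mem_map, Prod.mk.injEq] at hn
        obtain ⟨V', -, a', -, U, hU, h1, rfl, rfl⟩ := hn
        rw [Encodable.encode_injective h1]
        exact ⟨_, d.mem_runs_append_singleton.2 ⟨V, hV, U, hU, rfl⟩, rfl⟩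
      · rintro ⟨W, hW, rfl⟩
        obtain ⟨V, hV, U, hU, rfl⟩ := d.mem_runs_append_singleton.1 hW
        refine ⟨_, (ih _).2 ⟨V, hV, rfl⟩, ?_⟩
        change (_, a, _) ∈ (d.automaton F acc).2.1
        simp only [automaton, List.mem_flatMap, List.mem_map, Prod.mk.injEq]
        exact ⟨V, d.runs_subset hF w V hV, a, by simp, U, hU, rfl, rfl, rfl⟩
  change (∃ n ∈ (d.automaton F acc).toNFA.accept, n ∈ _) ↔ _
  constructor
  · rintro ⟨n, hn, hn'⟩
    obtain ⟨V, hV, rfl⟩ := (key n).1 hn'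
    obtain ⟨V', hV', h⟩ := List.mem_map.1 (show _ ∈ acc.map Encodable.encode from hn)
    exact ⟨V, Encodable.encode_injective h ▸ hV', hV⟩
  · rintro ⟨V, hV, hV'⟩
    exact ⟨_, (List.mem_map_of_mem hV : _ ∈ acc.map Encodable.encode), (key _).2 ⟨V, hV', rfl⟩⟩

end TransitionData

/-! ### Certificates for coverability -/

theorem separable_iUnion {A ι : Type*} [Finite ι] {C : Set (Language A)}
    (hC : IsQuotientClosedBooleanAlgebra C) (L : Language A) (L' : ι → Language A)
    (h : ∀ i, Separable C L (L' i)) : Separable C L ({w | ∃ i, w ∈ L' i} : Language A) := by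
  choose K hK h1 h2 using h
  refine ⟨_, hC.forall_mem (Set.finite_range K) (by rintro _ ⟨i, rfl⟩; exact hK i), ?_, ?_⟩
  · rintro w hw _ ⟨i, rfl⟩
    exact h1 i hw
  · refine eq_bot_iff.2 ?_
    rintro w ⟨⟨i, hi⟩, hw⟩
    have : w ∈ L' i ⊓ K i := ⟨hi, hw _ ⟨i, rfl⟩⟩
    exact h2 i ▸ this

theorem Separable.mono {A : Type*} {C : Set (Language A)} {L L₁ L₂ : Language A}
    (h : Separable C L L₂) (h' : L₁ ≤ L₂) : Separable C L L₁ := by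
  obtain ⟨K, hK, h1, h2⟩ := h
  refine ⟨K, hK, h1, eq_bot_iff.2 ?_⟩
  rw [← h2]
  exact inf_le_inf_right K h'

/-- Emptiness of a regular language thereby becomes an instance of `C`-separation. -/
theorem separable_top_iff {A : Type*} {C : Set (Language A)}
    (hC : IsQuotientClosedBooleanAlgebra C) (L : Language A) : Separable C L ⊤ ↔ L = ⊥ := by
  constructor
  · rintro ⟨K, -, h1, h2⟩
    rw [top_inf_eq] at h2
    exact eq_bot_iff.2 (h2 ▸ h1)
  · rintro rfl
    exact ⟨⊥, hC.bot_mem, le_rfl, inf_bot_eq _⟩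

namespace TransitionData

open Classical in
/-- The list `F` is the code of a saturated family from which no set satisfying `bad` can be
reached. -/
def IsCertificate {σ A : Type*} [Encodable σ] [Finite A] (C : Set (Language A))
    (d : TransitionData σ A) (bad : List (List (σ × σ)) → Prop)
    (F : List (List (List (σ × σ)))) : Prop :=
  (d.oneSet ∈ F ∧ ∀ T ∈ F, ∀ T' ∈ F, d.mulSet T T' ∈ F) ∧
    (∀ T ∈ d.relSets, Separable C {[]} (Automaton.language (d.automaton F [T])) ∨
      ∃ U ∈ F, (∀ s ∈ d.powSet T d.relSets.length, s ∈ U) ∧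
        ∀ s ∈ d.powSet T (d.relSets.length + 1), s ∈ U) ∧
    Separable C (Automaton.language (d.automaton F (d.relSets.filter fun T => bad T))) ⊤

/-- A certificate decodes to a saturated family. Conversely, a family is encoded by the list of all
codes of its members. -/
theorem exists_isCertificate_iff {σ A : Type*} [Encodable σ] [Finite A] {C : Set (Language A)}
    (hC : IsQuotientClosedBooleanAlgebra C) (d : TransitionData σ A)
    {bad : List (List (σ × σ)) → Prop} {bad' : Set (RelMonoid {p // p ∈ d.1}) → Prop}
    (hbad : ∀ T ∈ d.relSets, bad T ↔ bad' (d.denSet T)) :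
    (∃ F ∈ subl d.relSets, d.IsCertificate C bad F) ↔
      ∃ F, IsSaturatedFamily C d.letterRel d.relSets.length F ∧
        ∀ w, ∀ T ∈ reach F d.letterRel w, ¬ bad' T := by
  classical
  constructor
  · rintro ⟨F, hF, ⟨hone, hmul⟩, hpow, hno⟩
    have hF' := mem_of_mem_subl hF
    refine ⟨d.denFamily F, ⟨⟨_, hone, d.denSet_oneSet⟩, ?_, ?_⟩, ?_⟩
    · rintro _ ⟨T, hT, rfl⟩ _ ⟨T', hT', rfl⟩
      exact ⟨_, hmul T hT T' hT', d.denSet_mulSet T T'⟩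
    · intro S hS
      by_contra hU
      -- A set may have several codes. Each of them is separable from the empty word, hence so is
      -- their finite union, which covers all words reaching `S`.
      have h1 : ∀ T : {T // T ∈ d.relSets ∧ d.denSet T = S},
          Separable C {[]} (Automaton.language (d.automaton F [T.1])) := by
        rintro ⟨T, hT, rfl⟩
        refine (hpow T hT).resolve_right ?_
        rintro ⟨U, hUF, h1, h2⟩
        refine hU ⟨_, ⟨U, hUF, rfl⟩, ?_, ?_⟩
        · rw [← denSet_powSet]
          exact d.denSet_mono h1
        · rw [← denSet_powSet]
          exact d.denSet_mono h2
      have : Finite {T // T ∈ d.relSets ∧ d.denSet T = S} :=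
        ((List.finite_toSet d.relSets).subset fun T hT => hT.1).to_subtype
      refine hS ((separable_iUnion hC _ _ h1).mono fun w hw => ?_)
      obtain ⟨V, hV, rfl⟩ := (d.mem_reach_iff F w S).1 hw
      exact ⟨⟨V, d.runs_subset hF' w V hV, rfl⟩,
        (d.mem_language_automaton hF' w).2 ⟨V, List.mem_singleton_self V, hV⟩⟩
    · intro w S hS hbS
      obtain ⟨V, hV, rfl⟩ := (d.mem_reach_iff F w S).1 hS
      have hVm := d.runs_subset hF' w V hV
      rw [separable_top_iff hC] at hno
      have : w ∈ (⊥ : Language A) := hno ▸ (d.mem_language_automaton hF' w).2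
        ⟨V, by simp [hVm, (hbad V hVm).2 hbS], hV⟩
      exact this
  · rintro ⟨F, hF, hno⟩
    let F' := d.relSets.filter fun T => d.denSet T ∈ F
    have hF' : ∀ T, T ∈ F' ↔ T ∈ d.relSets ∧ d.denSet T ∈ F := by simp [F']
    have hF'' : ∀ T ∈ F', T ∈ d.relSets := fun T hT => ((hF' T).1 hT).1
    have hden : d.denFamily F' = F := by
      ext S
      constructor
      · rintro ⟨T, hT, rfl⟩
        exact ((hF' T).1 hT).2
      · intro hS
        refine ⟨_, (hF' _).2 ⟨d.ofSet_mem _, ?_⟩, d.denSet_ofSet S⟩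
        rwa [denSet_ofSet]
    refine ⟨F', filter_mem_subl _ _, ⟨?_, ?_⟩, ?_, ?_⟩
    · exact (hF' _).2 ⟨d.ofSet_mem _, by rw [denSet_oneSet]; exact hF.one_mem⟩
    · intro T hT T' hT'
      refine (hF' _).2 ⟨d.ofSet_mem _, ?_⟩
      rw [denSet_mulSet]
      exact hF.mul_mem _ ((hF' _).1 hT).2 _ ((hF' _).1 hT').2
    · intro T hT
      by_contra h
      rw [not_or] at h
      obtain ⟨U, hU, h1, h2⟩ := hF.pow_mem (d.denSet T) fun hs => h.1 <| hs.mono fun w hw => by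
        obtain ⟨V, hV, hVw⟩ := (d.mem_language_automaton hF'' w).1 hw
        rw [List.mem_singleton.1 hV] at hVw
        change _ ∈ reach F _ w
        rw [← hden]
        exact (d.mem_reach_iff F' w _).2 ⟨T, hVw, rfl⟩
      refine h.2 ⟨d.ofSet fun s => d.den s ∈ U, (hF' _).2 ⟨d.ofSet_mem _, ?_⟩, ?_, ?_⟩
      · rwa [denSet_ofSet]
      · rw [← denSet_powSet] at h1
        exact fun s hs => mem_ofSet.2 ⟨mem_of_mem_subl (d.powSet_mem _ _) s hs, h1 ⟨s, hs, rfl⟩⟩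
      · rw [← denSet_powSet] at h2
        exact fun s hs => mem_ofSet.2 ⟨mem_of_mem_subl (d.powSet_mem _ _) s hs, h2 ⟨s, hs, rfl⟩⟩
    · rw [separable_top_iff hC]
      refine eq_bot_iff.2 fun w hw => ?_
      obtain ⟨V, hV, hVw⟩ := (d.mem_language_automaton hF'' w).1 hw
      simp only [List.mem_filter, decide_eq_true_eq] at hV
      refine (hno w (d.denSet V) ?_ ((hbad V hV.1).1 hV.2)).elim
      rw [← hden]
      exact (d.mem_reach_iff F' w _).2 ⟨V, hVw, rfl⟩

end TransitionData

/-! ### The automata given as inputs -/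

/-- The language of an automaton, or its complement. -/
def signedLanguage {A : Type*} (c : Bool × Automaton A) : Language A :=
  {w | w ∈ Automaton.language c.2 ↔ c.1 = true}

/-- The disjoint union of the automata of an input. -/
def inputData {A : Type*} (x : Automaton A × List (Bool × Automaton A)) :
    TransitionData (Automaton A × ℕ) A :=
  ((x.1 :: x.2.map Prod.snd).flatMap fun N =>
      (N.1 ++ (N.2.1.map fun t => t.1) ++ N.2.2).map fun p => (N, p),
    (x.1 :: x.2.map Prod.snd).flatMap fun N => N.2.1.map fun t => ((N, t.1), t.2.1, (N, t.2.2)))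

/-- The relation with code `s` leads from an initial to a final state of `N`. -/
def Accepts {A : Type*} (N : Automaton A) (s : List ((Automaton A × ℕ) × (Automaton A × ℕ))) :
    Prop :=
  ∃ x ∈ s, (x.1.1 = N ∧ x.1.2 ∈ N.1) ∧ x.2.1 = N ∧ x.2.2 ∈ N.2.2

/-- The set of relations with code `T` meets the languages of the input. -/
def MeetsAll {A : Type*} (x : Automaton A × List (Bool × Automaton A))
    (T : List (List ((Automaton A × ℕ) × (Automaton A × ℕ)))) : Prop :=
  (∃ s ∈ T, Accepts x.1 s) ∧
    ∀ c ∈ x.2, ∃ s ∈ T, (Accepts c.2 s ∧ c.1 = true) ∨ (¬ Accepts c.2 s ∧ c.1 = false)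

/-- The relations that lead from an initial to a final state of `N`. -/
def acceptingRels {A : Type*} (d : TransitionData (Automaton A × ℕ) A) (N : Automaton A) :
    Set (RelMonoid {p // p ∈ d.1}) :=
  {m | ∃ p q, m p q ∧ (p.1.1 = N ∧ p.1.2 ∈ N.1) ∧ q.1.1 = N ∧ q.1.2 ∈ N.2.2}

theorem accepts_iff {A : Type*} {d : TransitionData (Automaton A × ℕ) A} {N : Automaton A}
    {s : List ((Automaton A × ℕ) × (Automaton A × ℕ))} (hs : s ∈ d.rels) :
    Accepts N s ↔ d.den s ∈ acceptingRels d N := by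
  constructor
  · rintro ⟨x, hx, h⟩
    have := mem_pairs.1 (mem_of_mem_subl hs x hx)
    exact ⟨⟨x.1, this.1⟩, ⟨x.2, this.2⟩, hx, h⟩
  · rintro ⟨p, q, hpq, h⟩
    exact ⟨_, hpq, h⟩

/-- States are tagged with their automaton, so a path that ends in a state of `N` stays in `N`
throughout. -/
theorem mem_language_iff {A : Type*} {x : Automaton A × List (Bool × Automaton A)}
    {N : Automaton A} (hN : N ∈ x.1 :: x.2.map Prod.snd) (w : List A) :
    w ∈ Automaton.language N ↔
      wordValue (inputData x).letterRel w ∈ acceptingRels (inputData x) N := by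
  -- Targets of transitions are not listed as such: every state of an accepting run is the source of
  -- a transition or final.
  have hmem : ∀ p, (p ∈ N.1 ∨ (∃ t ∈ N.2.1, t.1 = p) ∨ p ∈ N.2.2) → (N, p) ∈ (inputData x).1 := by
    intro p hp
    refine List.mem_flatMap.2 ⟨N, hN, List.mem_map.2 ⟨p, ?_, rfl⟩⟩
    simpa [or_assoc] using hp
  have hE : ∀ y a p, (y, a, (N, p)) ∈ (inputData x).2 ↔ y.1 = N ∧ (y.2, a, p) ∈ N.2.1 := by
    rintro ⟨N', q⟩ a p
    constructor
    · intro h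
      obtain ⟨N'', -, h⟩ := List.mem_flatMap.1 h
      obtain ⟨⟨t₁, t₂, t₃⟩, ht, h⟩ := List.mem_map.1 h
      simp only [Prod.mk.injEq] at h
      obtain ⟨⟨rfl, rfl⟩, rfl, rfl, rfl⟩ := h
      exact ⟨rfl, ht⟩
    · rintro ⟨rfl, h⟩
      exact List.mem_flatMap.2 ⟨_, hN, List.mem_map.2 ⟨_, h, rfl⟩⟩
  have key : ∀ (w : List A) (p q : {p // p ∈ (inputData x).1}), q.1.1 = N →
      (wordValue (inputData x).letterRel w p q ↔
        p.1.1 = N ∧ q.1.2 ∈ N.toNFA.evalFrom {p.1.2} w) := by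
    intro w
    induction w using List.reverseRecOn with
    | nil =>
      intro p q hq
      rw [wordValue_nil, RelMonoid.one_apply, NFA.evalFrom_nil, Set.mem_singleton_iff]
      constructor
      · rintro rfl
        exact ⟨hq, rfl⟩
      · rintro ⟨h1, h2⟩
        exact Subtype.ext (Prod.ext (h1.trans hq.symm) h2.symm)
    | append_singleton w a ih =>
      rintro p ⟨⟨_, q⟩, hq⟩ rfl
      rw [wordValue_append, RelMonoid.mul_apply, NFA.evalFrom_append, NFA.evalFrom_singleton,
        NFA.mem_stepSet, wordValue_cons, wordValue_nil, mul_one]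
      constructor
      · rintro ⟨r, h1, h2⟩
        obtain ⟨h3, h4⟩ := (hE _ _ _).1 h2
        obtain ⟨h5, h6⟩ := (ih p r h3).1 h1
        exact ⟨h5, r.1.2, h6, h4⟩
      · rintro ⟨h1, r, h2, h3⟩
        have hr := hmem r (Or.inr (Or.inl ⟨_, h3, rfl⟩))
        exact ⟨⟨_, hr⟩, (ih p ⟨_, hr⟩ rfl).2 ⟨h1, h2⟩, (hE _ _ _).2 ⟨rfl, h3⟩⟩
  change (∃ q ∈ N.toNFA.accept, q ∈ N.toNFA.evalFrom N.toNFA.start w) ↔ _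
  constructor
  · rintro ⟨q, hq, hqw⟩
    obtain ⟨p, hp, hpq⟩ := NFA.mem_evalFrom_iff_exists.1 hqw
    exact ⟨⟨(N, p), hmem p (Or.inl hp)⟩, ⟨(N, q), hmem q (Or.inr (Or.inr hq))⟩,
      (key w _ _ rfl).2 ⟨rfl, hpq⟩, ⟨rfl, hp⟩, rfl, hq⟩
  · rintro ⟨p, q, hpq, ⟨-, hp⟩, hqN, hq⟩
    exact ⟨q.1.2, hq, NFA.mem_evalFrom_iff_exists.2 ⟨p.1.2, hp, ((key w p q hqN).1 hpq).2⟩⟩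

theorem coverable_iff_exists_isCertificate {A : Type*} [Finite A] [Encodable A]
    {C : Set (Language A)} (hC : IsQuotientClosedBooleanAlgebra C)
    (hgroup : ∀ L ∈ C, IsGroupLanguage L) (x : Automaton A × List (Bool × Automaton A)) :
    Coverable (StarFreeClosure C) (Automaton.language x.1) {L | ∃ c ∈ x.2, signedLanguage c = L} ↔
      ∃ F ∈ subl (inputData x).relSets, (inputData x).IsCertificate C (MeetsAll x) F := by
  let P := acceptingRels (inputData x) x.1
  let Q : {c // c ∈ x.2} → Set (RelMonoid {p // p ∈ (inputData x).1}) := fun c =>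
    {m | m ∈ acceptingRels (inputData x) c.1.2 ↔ c.1.1 = true}
  let L' : {c // c ∈ x.2} → Language A := fun c => signedLanguage c.1
  have hP : ∀ w, w ∈ Automaton.language x.1 ↔ wordValue (inputData x).letterRel w ∈ P :=
    fun w => mem_language_iff (by simp) w
  have hQ : ∀ i w, w ∈ L' i ↔ wordValue (inputData x).letterRel w ∈ Q i := by
    rintro ⟨c, hc⟩ w
    change (w ∈ Automaton.language c.2 ↔ c.1 = true) ↔ (_ ↔ c.1 = true)
    rw [mem_language_iff (x := x) (List.mem_cons_of_mem _ (List.mem_map.2 ⟨c, hc, rfl⟩))]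
  have hL' : {L | ∃ c ∈ x.2, signedLanguage c = L} = Set.range L' := by
    ext L
    simp [L']
  have hmeets : ∀ T ∈ (inputData x).relSets, MeetsAll x T ↔
      Meets P Q ((inputData x).denSet T) := by
    intro T hT
    have hT' := mem_of_mem_subl hT
    refine and_congr ?_ ?_
    · constructor
      · rintro ⟨s, hs, h⟩
        exact ⟨_, ⟨s, hs, rfl⟩, (accepts_iff (hT' s hs)).1 h⟩
      · rintro ⟨_, ⟨s, hs, rfl⟩, h⟩
        exact ⟨s, hs, (accepts_iff (hT' s hs)).2 h⟩
    · rw [Subtype.forall]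
      refine forall₂_congr fun c hc => ?_
      have hsign : ∀ s ∈ T, ((Accepts c.2 s ∧ c.1 = true) ∨ (¬ Accepts c.2 s ∧ c.1 = false)) ↔
          (inputData x).den s ∈ Q ⟨c, hc⟩ := by
        intro s hs
        change _ ↔ (_ ∈ acceptingRels _ c.2 ↔ c.1 = true)
        rw [accepts_iff (hT' s hs)]
        cases c.1 <;> simp
      constructor
      · rintro ⟨s, hs, h⟩
        exact ⟨_, ⟨s, hs, rfl⟩, (hsign s hs).1 h⟩
      · rintro ⟨_, ⟨s, hs, rfl⟩, h⟩
        exact ⟨s, hs, (hsign s hs).2 h⟩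
  have : Finite {p // p ∈ (inputData x).1} := (List.finite_toSet (inputData x).1).to_subtype
  rw [TransitionData.exists_isCertificate_iff hC _ hmeets, hL']
  constructor
  · exact exists_isSaturatedFamily hC hgroup _
      (exists_pow_eq_of_card_le (inputData x).card_le) hP hQ
  · rintro ⟨F, hF, h⟩
    exact coverable_of_isSaturatedFamily hC hgroup _ hP hQ hF h

/-! ### Decidability -/

theorem language_nil_automaton {A : Type*} :
    Automaton.language (([0], [], [0]) : Automaton A) = {[]} := by
  ext w
  change (∃ q ∈ (Automaton.toNFA ([0], [], [0])).accept, q ∈ _) ↔ w = []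
  cases w with
  | nil => simp [Automaton.toNFA]
  | cons a w =>
    have : ∀ v : List A, (Automaton.toNFA (([0], [], [0]) : Automaton A)).evalFrom ∅ v = ∅ := by
      intro v
      induction v with
      | nil => rfl
      | cons b v ih => rw [NFA.evalFrom_cons, NFA.stepSet_empty, ih]
    have h : (Automaton.toNFA (([0], [], [0]) : Automaton A)).stepSet {p | p ∈ [0]} a = ∅ := by
      ext q
      simp [Automaton.toNFA]
    simp only [reduceCtorEq, iff_false]
    change ¬ ∃ q ∈ _, q ∈ NFA.evalFrom _ (NFA.stepSet _ {p | p ∈ [0]} a) w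
    rw [h, this]
    simp

theorem exists_automaton_top (A : Type*) [Finite A] :
    ∃ M : Automaton A, Automaton.language M = ⊤ :=
  (isRegular_iff_exists_automaton _).1
    ⟨Unit, inferInstance, ⟨fun _ _ => (), (), Set.univ⟩, Set.ext fun _ => ⟨fun _ => trivial,
      fun _ => trivial⟩⟩

/-! ### Computability of the search for certificates -/

section

variable {A : Type*} [Primcodable A]

theorem primrec_inputData :
    Primrec (inputData : Automaton A × List (Bool × Automaton A) → _) := by
  have hl : Primrec fun x : Automaton A × List (Bool × Automaton A) =>
      x.1 :: x.2.map Prod.snd :=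
    Primrec.list_cons.comp Primrec.fst (Primrec.list_map Primrec.snd
      (Primrec.snd.comp Primrec.snd))
  refine Primrec.pair (Primrec.list_flatMap hl (Primrec.list_map ?_ ?_))
    (Primrec.list_flatMap hl (Primrec.list_map ?_ ?_))
  · have hN : Primrec fun y : (Automaton A × List (Bool × Automaton A)) × Automaton A => y.2 :=
      Primrec.snd
    refine Primrec.list_append.comp (Primrec.list_append.comp (Primrec.fst.comp hN) ?_)
      (Primrec.snd.comp (Primrec.snd.comp hN))
    exact Primrec.list_map (Primrec.fst.comp (Primrec.snd.comp hN))
      (Primrec.fst.comp Primrec.snd)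
  · exact Primrec.pair (Primrec.snd.comp Primrec.fst) Primrec.snd
  · exact Primrec.fst.comp (Primrec.snd.comp Primrec.snd)
  · have hN : Primrec fun y : ((Automaton A × List (Bool × Automaton A)) × Automaton A) ×
        (ℕ × A × ℕ) => y.1.2 := Primrec.snd.comp Primrec.fst
    have ht : Primrec fun y : ((Automaton A × List (Bool × Automaton A)) × Automaton A) ×
        (ℕ × A × ℕ) => y.2 := Primrec.snd
    exact Primrec.pair (Primrec.pair hN (Primrec.fst.comp ht)) (Primrec.pair
      (Primrec.fst.comp (Primrec.snd.comp ht))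
      (Primrec.pair hN (Primrec.snd.comp (Primrec.snd.comp ht))))

theorem primrecPred_accepts {α : Type*} [Primcodable α] {N : α → Automaton A}
    {s : α → List ((Automaton A × ℕ) × (Automaton A × ℕ))} (hN : Primrec N) (hs : Primrec s) :
    PrimrecPred fun a => Accepts (N a) (s a) := by
  have hx : Primrec fun y : α × ((Automaton A × ℕ) × (Automaton A × ℕ)) => y.2 := Primrec.snd
  have hN' : Primrec fun y : α × ((Automaton A × ℕ) × (Automaton A × ℕ)) => N y.1 :=
    hN.comp Primrec.fst
  refine primrecPred_exists_mem hs (PrimrecPred.and (PrimrecPred.and ?_ ?_)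
    (PrimrecPred.and ?_ ?_))
  · exact primrecPred_eq (Primrec.fst.comp (Primrec.fst.comp hx)) hN'
  · exact primrecPred_mem (Primrec.snd.comp (Primrec.fst.comp hx)) (Primrec.fst.comp hN')
  · exact primrecPred_eq (Primrec.fst.comp (Primrec.snd.comp hx)) hN'
  · exact primrecPred_mem (Primrec.snd.comp (Primrec.snd.comp hx))
      (Primrec.snd.comp (Primrec.snd.comp hN'))

set_option synthInstance.maxSize 512 in
theorem primrecRel_meetsAll :
    PrimrecRel (MeetsAll : Automaton A × List (Bool × Automaton A) → _ → Prop) := by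
  refine PrimrecPred.and (primrecPred_exists_mem Primrec.snd ?_) (primrecPred_forall_mem
    (Primrec.snd.comp Primrec.fst) (primrecPred_exists_mem (Primrec.snd.comp Primrec.fst)
      (PrimrecPred.or (PrimrecPred.and ?_ ?_) (PrimrecPred.and (PrimrecPred.not ?_) ?_))))
  · exact primrecPred_accepts (Primrec.fst.comp (Primrec.fst.comp Primrec.fst)) Primrec.snd
  · exact primrecPred_accepts (Primrec.snd.comp (Primrec.snd.comp Primrec.fst)) Primrec.snd
  · exact primrecPred_eq (Primrec.fst.comp (Primrec.snd.comp Primrec.fst)) (Primrec.const true)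
  · exact primrecPred_accepts (Primrec.snd.comp (Primrec.snd.comp Primrec.fst)) Primrec.snd
  · exact primrecPred_eq (Primrec.fst.comp (Primrec.snd.comp Primrec.fst)) (Primrec.const false)

variable {C : Set (Language A)}

theorem DecidableSeparation.separable (hsep : DecidableSeparation C) {α : Type*} [Primcodable α]
    {M N : α → Automaton A} (hM : Primrec M) (hN : Primrec N) :
    ComputablePred fun a => Separable C (Automaton.language (M a)) (Automaton.language (N a)) :=
  computablePred_comp (p := fun x : Automaton A × Automaton A =>
    Separable C (Automaton.language x.1) (Automaton.language x.2)) hsep (Primrec.pair hM hN).to_comp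

variable [Finite A]

theorem TransitionData.computablePred_exists_isCertificate (hsep : DecidableSeparation C)
    {X σ : Type*} [Primcodable X] [Primcodable σ] {d : X → TransitionData σ A} (hd : Primrec d)
    {bad : X → List (List (σ × σ)) → Prop} (hbad : PrimrecRel bad) :
    ComputablePred fun x => ∃ F ∈ subl (d x).relSets, (d x).IsCertificate C (bad x) F := by
  classical
  have hrel : Primrec fun x => (d x).relSets := primrec_relSets.comp hd
  have hx : Primrec fun y : X × List (List (List (σ × σ))) => y.1 := Primrec.fst
  have hF : Primrec fun y : X × List (List (List (σ × σ))) => y.2 := Primrec.snd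
  have hdx := hd.comp hx
  refine computablePred_exists_mem (p := fun y => (d y.1).IsCertificate C (bad y.1) y.2)
    (primrec_subl.comp hrel).to_comp (computablePred_and ?_ (computablePred_and ?_ ?_))
  · refine PrimrecPred.computablePred (PrimrecPred.and ?_ ?_)
    · exact primrecPred_mem (primrec_oneSet.comp hdx) hF
    · refine primrecPred_forall_mem hF (primrecPred_forall_mem (hF.comp Primrec.fst) ?_)
      exact primrecPred_mem (primrec_mulSet (hdx.comp (Primrec.fst.comp Primrec.fst))
        (Primrec.snd.comp Primrec.fst) Primrec.snd) (hF.comp (Primrec.fst.comp Primrec.fst))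
  · have hT : Primrec fun z : (X × List (List (List (σ × σ)))) × List (List (σ × σ)) => z.2 :=
      Primrec.snd
    have hd' : Primrec fun z : (X × List (List (List (σ × σ)))) × List (List (σ × σ)) =>
        d z.1.1 := hdx.comp Primrec.fst
    have hlen : Primrec fun z : (X × List (List (List (σ × σ)))) × List (List (σ × σ)) =>
        (d z.1.1).relSets.length := Primrec.list_length.comp (primrec_relSets.comp hd')
    refine computablePred_forall_mem (l := fun y : X × List (List (List (σ × σ))) =>
        (d y.1).relSets)
      (p := fun z : (X × List (List (List (σ × σ)))) × List (List (σ × σ)) =>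
        Separable C {[]} (Automaton.language ((d z.1.1).automaton z.1.2 [z.2])) ∨
          ∃ U ∈ z.1.2, (∀ s ∈ (d z.1.1).powSet z.2 (d z.1.1).relSets.length, s ∈ U) ∧
            ∀ s ∈ (d z.1.1).powSet z.2 ((d z.1.1).relSets.length + 1), s ∈ U)
      (hrel.comp hx).to_comp (computablePred_or ?_ (PrimrecPred.computablePred ?_))
    · rw [← language_nil_automaton]
      exact hsep.separable (Primrec.const _) (primrec_automaton hd' (hF.comp Primrec.fst)
        (Primrec.list_cons.comp hT (Primrec.const [])))
    · have hmem : PrimrecRel fun (u : ((X × List (List (List (σ × σ)))) × List (List (σ × σ))) ×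
          List (List (σ × σ))) (s : List (σ × σ)) => s ∈ u.2 :=
        primrecPred_mem (f := fun v : (((X × List (List (List (σ × σ)))) × List (List (σ × σ))) ×
          List (List (σ × σ))) × List (σ × σ) => v.2) (g := fun v => v.1.2)
          Primrec.snd (Primrec.snd.comp Primrec.fst)
      have hsub : ∀ {n : (X × List (List (List (σ × σ)))) × List (List (σ × σ)) → ℕ},
          Primrec n → PrimrecPred
            fun u : ((X × List (List (List (σ × σ)))) × List (List (σ × σ))) ×
              List (List (σ × σ)) => ∀ s ∈ (d u.1.1.1).powSet u.1.2 (n u.1), s ∈ u.2 := fun hn =>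
        primrecPred_forall_mem (primrec_powSet (hd'.comp Primrec.fst) (hT.comp Primrec.fst)
          (hn.comp Primrec.fst)) hmem
      exact primrecPred_exists_mem (hF.comp Primrec.fst)
        (PrimrecPred.and (hsub hlen) (hsub (Primrec.succ.comp hlen)))
  -- The automaton for all words does not depend on the input, so its mere existence suffices.
  · obtain ⟨M, hM⟩ := exists_automaton_top A
    rw [← hM]
    have hbad' : PrimrecRel fun (y : X × List (List (List (σ × σ)))) T => bad y.1 T :=
      PrimrecRel.comp (R := bad) (f := fun z : (X × List (List (List (σ × σ)))) ×
        List (List (σ × σ)) => z.1.1) hbad (hx.comp Primrec.fst) Primrec.snd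
    have hfilter : Primrec fun y : X × List (List (List (σ × σ))) =>
        (d y.1).relSets.filter fun T => bad y.1 T :=
      primrec_filter (R := fun (y : X × List (List (List (σ × σ)))) T => bad y.1 T)
        (primrec_relSets.comp hdx) hbad'
    have hacc := primrec_automaton hdx hF hfilter
    exact hsep.separable hacc (Primrec.const M)

theorem computablePred_signedCoverable (hC : IsQuotientClosedBooleanAlgebra C)
    (hgroup : ∀ L ∈ C, IsGroupLanguage L) (hsep : DecidableSeparation C) :
    ComputablePred fun x : Automaton A × List (Bool × Automaton A) =>
      Coverable (StarFreeClosure C) (Automaton.language x.1)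
        {L | ∃ c ∈ x.2, signedLanguage c = L} :=
  (TransitionData.computablePred_exists_isCertificate hsep primrec_inputData
    primrecRel_meetsAll).of_eq fun x =>
    (coverable_iff_exists_isCertificate hC hgroup x).symm

theorem decidableCovering_starFreeClosure (hC : IsQuotientClosedBooleanAlgebra C)
    (hgroup : ∀ L ∈ C, IsGroupLanguage L) (hsep : DecidableSeparation C) :
    DecidableCovering (StarFreeClosure C) := by
  have hmap : Primrec fun M : Automaton A × List (Automaton A) => M.2.map fun N => (true, N) :=
    Primrec.list_map Primrec.snd
      (Primrec₂.mk (f := fun (_ : Automaton A × List (Automaton A)) (N : Automaton A) => (true, N))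
        (Primrec.pair (Primrec.const true) Primrec.snd))
  refine (computablePred_comp (computablePred_signedCoverable hC hgroup hsep)
    (Primrec.pair Primrec.fst hmap).to_comp).of_eq fun M => ?_
  have h : ∀ N : Automaton A, signedLanguage (true, N) = Automaton.language N := fun N =>
    Set.ext fun w => iff_true_right rfl
  simp [h]

end

/-! ### Separation and membership as instances of covering -/

theorem separable_iff_coverable {A : Type*} {C : Set (Language A)} (hne : C.Nonempty)
    (L₁ L₂ : Language A) : Separable (StarFreeClosure C) L₁ L₂ ↔
      Coverable (StarFreeClosure C) L₁ {L | L₂ = L} := by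
  constructor
  · rintro ⟨K, hK, h1, h2⟩
    refine ⟨{K}, ⟨Set.finite_singleton K, by simpa using hK, fun w hw => ⟨K, rfl, h1 hw⟩⟩, ?_⟩
    rintro _ rfl
    exact ⟨L₂, rfl, by rw [inf_comm, h2]⟩
  · rintro ⟨D, ⟨hfin, hD, hcov⟩, h⟩
    refine ⟨_, InStarFreeClosure.biUnion hne hfin.toFinset id fun K hK => hD (by simpa using hK),
      fun w hw => ?_, ?_⟩
    · obtain ⟨K, hK, hwK⟩ := hcov w hw
      exact ⟨K, by simpa using hK, hwK⟩
    · refine eq_bot_iff.2 ?_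
      rintro w ⟨hw, K, hK, hwK⟩
      obtain ⟨_, rfl, hKL⟩ := h K (by simpa using hK)
      exact hKL ▸ (⟨hwK, hw⟩ : w ∈ K ⊓ L₂)

theorem mem_iff_separable_compl {A : Type*} {C : Set (Language A)} (L : Language A) :
    L ∈ C ↔ Separable C L Lᶜ := by
  constructor
  · exact fun h => ⟨L, h, le_rfl, compl_inf_eq_bot⟩
  · rintro ⟨K, hK, h1, h2⟩
    have : K = L := le_antisymm (fun w hw => by
      by_contra hwL
      have : w ∈ (⊥ : Language A) := h2 ▸ (⟨hwL, hw⟩ : w ∈ Lᶜ ⊓ K)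
      exact this) h1
    exact this ▸ hK

end StarFree

theorem theorem2 {A : Type*} [Finite A] [Primcodable A] (C : Set (Language A))
    (hC : StarFree.IsQuotientClosedBooleanAlgebra C)
    (hgroup : ∀ L ∈ C, StarFree.IsGroupLanguage L)
    (hsep : StarFree.DecidableSeparation C) :
    StarFree.DecidableMembership (StarFree.StarFreeClosure C) ∧
      StarFree.DecidableSeparation (StarFree.StarFreeClosure C) ∧
      StarFree.DecidableCovering (StarFree.StarFreeClosure C) := by
  have hcov := StarFree.computablePred_signedCoverable hC hgroup hsep
  refine ⟨?_, ?_, StarFree.decidableCovering_starFreeClosure hC hgroup hsep⟩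
  -- Membership is covering of the language against its own complement, given by the same automaton
  -- with the sign `false`.
  · refine (StarFree.computablePred_comp hcov
      (f := fun M : StarFree.Automaton A => (M, [(false, M)])) (Primrec.pair Primrec.id
        (Primrec.list_cons.comp (Primrec.pair (Primrec.const false) Primrec.id)
          (Primrec.const []))).to_comp).of_eq fun M => ?_
    rw [StarFree.mem_iff_separable_compl, StarFree.separable_iff_coverable hC.nonempty]
    have h : StarFree.signedLanguage (false, M) = (StarFree.Automaton.language M)ᶜ :=
      Set.ext fun w => by
        change (w ∈ StarFree.Automaton.language M ↔ false = true) ↔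
          ¬ w ∈ StarFree.Automaton.language M
        simp
    simp [h]
  · refine (StarFree.computablePred_comp hcov
      (f := fun M : StarFree.Automaton A × StarFree.Automaton A => (M.1, [(true, M.2)]))
      (Primrec.pair Primrec.fst (Primrec.list_cons.comp
        (Primrec.pair (Primrec.const true) Primrec.snd) (Primrec.const []))).to_comp).of_eq
      fun M => ?_
    rw [StarFree.separable_iff_coverable hC.nonempty]
    have h : StarFree.signedLanguage (true, M.2) = StarFree.Automaton.language M.2 :=
      Set.ext fun w => iff_true_right rfl
    simp [h]
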